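/- **Setting.** Let $L$ (levels) and $B$ (blames) be bounded lattices and $\beta : L \to B$ a lattice isomorphism (preserving joins and meets). An *index* $i$ is a level or a blame; a level $\ell$ is placed at $(\ell,\bot)$ and a blame $b$ at $(\bot,b)$ in $L\times B$, and $\sqsubseteq,\sqcup$ on indices are those of $L\times B$. *Types:* $s,t ::= \mathsf{unit} \mid s\to t \mid s\times t \mid s+t \mid T_i(s) \mid \overline T_\ell(s) \mid s^\ell$, identified along the congruence generated by $(s^\ell)^{\ell'}=s^{\ell\sqcup\ell'}$, $s=s^\bot$, $\mathsf{unit}^\ell=\mathsf{unit}$, $(s\times t)^\ell=s^\ell\times t^\ell$, $(s\to t)^\ell=s\to t^\ell$, $\overline T_{\ell'}(s)^\ell=\overline T_{\ell'}(s^\ell)$, $T_i(s)^\ell=T_i(s^\ell)$, and, if $\ell\sqsubseteq\ell'$ (resp. $\ell\sqsubseteq i$), $\overline T_{\ell'}(s)^\ell=\overline T_{\ell'}(s)$ (resp. $T_i(s)^\ell=T_i(s)$). $\mathcal B(t)$ is the join of all blames that occur in $t$. *Terms:* $e ::= x \mid () \mid \lambda x.e \mid e\,e' \mid \langle e,e'\rangle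 \mid \mathsf{proj}_k e \mid \mathsf{inj}_k e \mid \mathsf{case}\ e\ \mathsf{of}\ \mathsf{inj}_1(x).e_1\,\|\,\mathsf{inj}_2(x).e_2 \mid \eta_i e \mid \overline\eta_\ell e \mid \mathsf{bind}\ x=e\ \mathsf{in}\ e' \mid \mathsf{weaken}\ e \mid e^\ell$ (the last, a tainted term, is internal). *Protection.* $i\preceq\mathsf{unit}$; $i\preceq s\to t$ iff $i\preceq t$; $i\preceq s\times t$ iff $i\preceq s$ and $i\preceq t$; $i\preceq T_j(s)$ iff $i\sqsubseteq j$ or $i\preceq s$; $i\preceq\overline T_\ell(s)$ iff $i\preceq s$; never for sums and open types $s^\ell$. Weak protection $\ell\le t$ is defined in the same way, except that $\ell\le s+t$ iff $\ell\le s$ and $\ell\le t$, and $\ell\le\overline T_{\ell'}(s)$ iff $\ell\sqsubseteq\ell'$ or $\ell\le s$. *Typing* $\Gamma;\Pi;\overline\Pi\vdash e:t$ (with $\Pi\in L\times B$, $\overline\Pi\in L$): the usual rules for variables, unit, functions, pairs, projections and injections, and - if $e:(s_1+s_2)^\ell$ and $\Gamma,x:s_k^\ell\vdash e_k:t$ ($k=1,2$),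 then $\mathsf{case}\ e\ \mathsf{of}\dots:t$; - if $\Gamma;\Pi\sqcup i;\overline\Pi\sqcup i\vdash e:s$, then $\Gamma;\Pi;\overline\Pi\vdash\eta_i e:T_i(s)$ (of $i$, only the level part is joined to $\overline\Pi$); - if $\Gamma;\Pi;\overline\Pi\sqcup\ell\vdash e:s$, then $\Gamma;\Pi;\overline\Pi\vdash\overline\eta_\ell e:\overline T_\ell(s)$; - if $e:T_i(s)$, $\Gamma,x:s\vdash e':t$, and $i\sqsubseteq\Pi$ or $i\preceq t$, then $\mathsf{bind}\ x=e\ \mathsf{in}\ e':t$; - if $e:\overline T_\ell(s)$, $\Gamma,x:s^\ell\vdash e':t$, and $\ell\sqsubseteq\overline\Pi$ or $\ell\le t$, then $\mathsf{bind}\ x=e\ \mathsf{in}\ e':t$; - if $e:T_\ell(s)$ with $\ell$ a level, then $\mathsf{weaken}\ e:T_{\beta(\ell)}(\overline T_\ell(s))$; - if $e:s$, then $e^\ell:s^\ell$. $\vdash e:t$ means that $e$ has type $t$ in the empty context with $\Pi=\overline\Pi=\bot$. *Evaluation* is call-by-name, with all introduction forms as (lazy) values, the usual $\beta$-rules, and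 $\mathsf{bind}\ x=\eta_i e\ \mathsf{in}\ e'\to e'[e/x]$, $\mathsf{bind}\ x=\overline\eta_\ell e\ \mathsf{in}\ e'\to e'[e^\ell/x]$, $\mathsf{case}\ (\mathsf{inj}_k e)^\ell\ \mathsf{of}\dots\to e_k[e^\ell/x]$, $\mathsf{weaken}\,(\eta_\ell e)\to\eta_{\beta(\ell)}(\overline\eta_\ell e)$. Taints are pushed into values as in the equations for open types (on $\lambda x.e$ into the body; dropped at $\overline\eta_{\ell'}$ and $\eta_i$ if $\ell\sqsubseteq\ell'$, resp. $\ell\sqsubseteq i$), nested taints are joined, and a tainted injection is a value. *Relations.* An observer is a pair $o=(\ell',\delta)\in L\times B$; it can open $T_i$ iff $i\sqsubseteq o$. "A term of type $s$" below means a closed term that has, in the underlying simply typed calculus (protection contexts, side conditions, open qualifiers ignored), the type $s$ with its qualifiers erased. Indistinguishability $e\sim_o e':t$ holds iff $e,e'$ evaluate to values of the form belonging to $t$ such that: both are $()$ at $\mathsf{unit}$; at $s\to t$, $v\,a\sim_o v'\,a':t$ for all terms $a\sim_o a'$ of type $s$; at $s\times t$, the components are related; at $s_1+s_2$, they are $\mathsf{inj}_k$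 with the same $k$ of related terms (taints ignored); at $T_i(s)$, they are $\eta_i a,\eta_i a'$ with $i\not\sqsubseteq o$ or $a\sim_o a':s$; at $\overline T_\ell(s)$, they are $\overline\eta_\ell a,\overline\eta_\ell a'$ with $a\sim_o a':s$; and $\sim_o$ at $s^\ell$ is $\sim_o$ at $s$. Safety $e\rhd_o:t$ is the unary analogue, except that: at $s_1+s_2$ the value is $(\mathsf{inj}_k a)^{\kappa}$ with taint $\kappa\sqsubseteq\ell'$ ($\kappa=\bot$ if untainted) and $a\rhd_o:s_k$; at $\overline T_\ell(s)$ it is $\overline\eta_\ell a$ with $\ell\not\sqsubseteq\ell'$ or $a\rhd_o:s$; at $s^\ell$, either $\ell\not\sqsubseteq\ell'$ and $e$ evaluates to some value, or $e\rhd_o:s$. **Theorem.** (1) If $\vdash e:T_\ell(s)\to t$ with $\ell\in L$, $\vdash e_1:s$, $\vdash e_2:s$ and $\ell\not\sqsubseteq\beta^{-1}(\mathcal B(t))$, then for every level $\ell'$ with $\ell\not\sqsubseteq\ell'$ and every blame $\delta$ with $\delta\sqcap\mathcal B(t)\sqsubseteq\beta(\ell')$ (for instance $\delta=\bot$, or $\delta=\beta(\ell')$,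 or $\delta=\top$ if $\beta^{-1}(\mathcal B(t))\sqsubseteq\ell'$), $$ e\,(\eta_\ell e_1)\ \sim_{(\ell',\delta)}\ e\,(\eta_\ell e_2) : t . $$ (2) If $\vdash e:\overline T_\ell(s)\to t$ and $\vdash e':s$, then $e\,(\overline\eta_\ell e')\rhd_{(\ell',\delta)}:t$ for every level $\ell'$ with $\ell\not\sqsubseteq\ell'$ and every blame $\delta$. -/

import Mathlib

namespace DCC

universe u v

/-- An index of the strong protection type `T`: either a protection level of the lattice `L`,
or a blame of the (separate) lattice `B`. -/
inductive Label (L : Type u) (B : Type v) where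
  | level (l : L)
  | blame (b : B)

/-- Levels and blames live in two separate lattices. Protection contexts are joins of levels and
blames, so they are elements of `L × B`; this is the position of a single index there.
In particular a nontrivial level and a nontrivial blame are never comparable. -/
def Label.pos {L : Type u} {B : Type v} [Lattice L] [BoundedOrder L] [Lattice B] [BoundedOrder B] :
    Label L B → L × B
  | .level l => (l, ⊥)
  | .blame b => (⊥, b)

/-- Types: `unit`, `s → t`, `s × t`, `s + t`, the strong protection type `T_i(s)` (`mon i s`),
the weak protection type `T̄_ℓ(s)` (`wmon ℓ s`), and the open type `s^ℓ` (`opn s ℓ`). -/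
inductive Ty (L : Type u) (B : Type v) where
  | unit
  | arr (s t : Ty L B)
  | prod (s t : Ty L B)
  | sum (s t : Ty L B)
  | mon (i : Label L B) (s : Ty L B)
  | wmon (l : L) (s : Ty L B)
  | opn (s : Ty L B) (l : L)

/-- Terms, with de Bruijn indices. `abs`, the branches of `case` and the body of `bind` bind
the variable `0`. `ret i e` is `η_i e`, `wret ℓ e` is `η̄_ℓ e`, and `taint ℓ e` is the
internal tainted term `e^ℓ`. The index `k : Bool` of `proj` and `inj` is `true` for the
first and `false` for the second component. -/
inductive Tm (L : Type u) (B : Type v) where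
  | var (n : ℕ)
  | unit
  | abs (e : Tm L B)
  | app (e a : Tm L B)
  | pair (e₁ e₂ : Tm L B)
  | proj (k : Bool) (e : Tm L B)
  | inj (k : Bool) (e : Tm L B)
  | case (e e₁ e₂ : Tm L B)
  | ret (i : Label L B) (e : Tm L B)
  | wret (l : L) (e : Tm L B)
  | bind (e a : Tm L B)
  | weaken (e : Tm L B)
  | taint (l : L) (e : Tm L B)

/-- The first of two things for `true`, the second for `false`. -/
def pick {α : Sort u} : Bool → α → α → α
  | true, a, _ => a
  | false, _, b => b

section Substitution

variable {L : Type u} {B : Type v}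

/-- Lifting of a renaming under a binder. -/
def liftRen (ρ : ℕ → ℕ) : ℕ → ℕ
  | 0 => 0
  | n + 1 => ρ n + 1

def Tm.rename (ρ : ℕ → ℕ) : Tm L B → Tm L B
  | .var n => .var (ρ n)
  | .unit => .unit
  | .abs e => .abs (e.rename (liftRen ρ))
  | .app e a => .app (e.rename ρ) (a.rename ρ)
  | .pair e₁ e₂ => .pair (e₁.rename ρ) (e₂.rename ρ)
  | .proj k e => .proj k (e.rename ρ)
  | .inj k e => .inj k (e.rename ρ)
  | .case e e₁ e₂ => .case (e.rename ρ) (e₁.rename (liftRen ρ)) (e₂.rename (liftRen ρ))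
  | .ret i e => .ret i (e.rename ρ)
  | .wret l e => .wret l (e.rename ρ)
  | .bind e a => .bind (e.rename ρ) (a.rename (liftRen ρ))
  | .weaken e => .weaken (e.rename ρ)
  | .taint l e => .taint l (e.rename ρ)

/-- Lifting of a substitution under a binder. -/
def liftSub (σ : ℕ → Tm L B) : ℕ → Tm L B
  | 0 => .var 0
  | n + 1 => (σ n).rename Nat.succ

def Tm.subst (σ : ℕ → Tm L B) : Tm L B → Tm L B
  | .var n => σ n
  | .unit => .unit
  | .abs e => .abs (e.subst (liftSub σ))
  | .app e a => .app (e.subst σ) (a.subst σ)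
  | .pair e₁ e₂ => .pair (e₁.subst σ) (e₂.subst σ)
  | .proj k e => .proj k (e.subst σ)
  | .inj k e => .inj k (e.subst σ)
  | .case e e₁ e₂ => .case (e.subst σ) (e₁.subst (liftSub σ)) (e₂.subst (liftSub σ))
  | .ret i e => .ret i (e.subst σ)
  | .wret l e => .wret l (e.subst σ)
  | .bind e a => .bind (e.subst σ) (a.subst (liftSub σ))
  | .weaken e => .weaken (e.subst σ)
  | .taint l e => .taint l (e.subst σ)

/-- `e[a/x]`, where `x` is the variable `0` of `e`. -/
def Tm.inst (e a : Tm L B) : Tm L B :=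
  e.subst fun n => match n with
    | 0 => a
    | n + 1 => .var n

end Substitution

section System

variable {L : Type u} {B : Type v} [Lattice L] [BoundedOrder L] [Lattice B] [BoundedOrder B]

/-- The blame carried by a type: the join of all blames that appear in it. -/
def Ty.blames : Ty L B → B
  | .unit => ⊥
  | .arr s t => s.blames ⊔ t.blames
  | .prod s t => s.blames ⊔ t.blames
  | .sum s t => s.blames ⊔ t.blames
  | .mon (.level _) s => s.blames
  | .mon (.blame b) s => b ⊔ s.blames
  | .wmon _ s => s.blames
  | .opn s _ => s.blames

/-- Removal of all qualifiers of open types. -/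
def Ty.erase : Ty L B → Ty L B
  | .unit => .unit
  | .arr s t => .arr s.erase t.erase
  | .prod s t => .prod s.erase t.erase
  | .sum s t => .sum s.erase t.erase
  | .mon i s => .mon i s.erase
  | .wmon l s => .wmon l s.erase
  | .opn s _ => s.erase

/-- `i ⪯ t`: the type `t` is protected at `i`. Sums and open types never are. -/
def Prot (i : Label L B) : Ty L B → Prop
  | .unit => True
  | .arr _ t => Prot i t
  | .prod s t => Prot i s ∧ Prot i t
  | .sum _ _ => False
  | .mon j s => i.pos ≤ j.pos ∨ Prot i s
  | .wmon _ s => Prot i s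
  | .opn _ _ => False

/-- `ℓ ≤ t`: the type `t` is weakly protected at `ℓ`. Open types never are. -/
def WProt (l : L) : Ty L B → Prop
  | .unit => True
  | .arr _ t => WProt l t
  | .prod s t => WProt l s ∧ WProt l t
  | .sum s t => WProt l s ∧ WProt l t
  | .mon j s => l ≤ j.pos.1 ∨ WProt l s
  | .wmon l' s => l ≤ l' ∨ WProt l s
  | .opn _ _ => False

/-- The congruence generated by the open type equations. -/
inductive TyEq : Ty L B → Ty L B → Prop
  | refl (s : Ty L B) : TyEq s s
  | symm {s t : Ty L B} : TyEq s t → TyEq t s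
  | trans {s t r : Ty L B} : TyEq s t → TyEq t r → TyEq s r
  | arr {s s' t t' : Ty L B} : TyEq s s' → TyEq t t' → TyEq (.arr s t) (.arr s' t')
  | prod {s s' t t' : Ty L B} : TyEq s s' → TyEq t t' → TyEq (.prod s t) (.prod s' t')
  | sum {s s' t t' : Ty L B} : TyEq s s' → TyEq t t' → TyEq (.sum s t) (.sum s' t')
  | mon (i : Label L B) {s s' : Ty L B} : TyEq s s' → TyEq (.mon i s) (.mon i s')
  | wmon (l : L) {s s' : Ty L B} : TyEq s s' → TyEq (.wmon l s) (.wmon l s')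
  | opn (l : L) {s s' : Ty L B} : TyEq s s' → TyEq (.opn s l) (.opn s' l)
  | opn_opn (s : Ty L B) (l l' : L) : TyEq (.opn (.opn s l) l') (.opn s (l ⊔ l'))
  | opn_bot (s : Ty L B) : TyEq s (.opn s ⊥)
  | opn_unit (l : L) : TyEq (.opn .unit l) .unit
  | opn_prod (s t : Ty L B) (l : L) :
      TyEq (.opn (.prod s t) l) (.prod (.opn s l) (.opn t l))
  | opn_arr (s t : Ty L B) (l : L) : TyEq (.opn (.arr s t) l) (.arr s (.opn t l))
  | opn_wmon (s : Ty L B) (l l' : L) : TyEq (.opn (.wmon l' s) l) (.wmon l' (.opn s l))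
  | opn_wmon_drop (s : Ty L B) {l l' : L} : l ≤ l' → TyEq (.opn (.wmon l' s) l) (.wmon l' s)
  | opn_mon (s : Ty L B) (l : L) (i : Label L B) :
      TyEq (.opn (.mon i s) l) (.mon i (.opn s l))
  | opn_mon_drop (s : Ty L B) {l : L} {i : Label L B} : l ≤ i.pos.1 →
      TyEq (.opn (.mon i s) l) (.mon i s)

/-- The typing judgment `Γ; Π; Π̄ ⊢ e : t`, written `HasType β Γ P Q e t`. Types are identified
along the open type equations by the rule `conv`; the last rule types the internal tainted
terms. The condition `i ⪯ T_Π(t)` of `bind` is spelled out as `i ⊑ Π` or `i ⪯ t`, and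
likewise for `ℓ ≤ T̄_Π̄(t)`. -/
inductive HasType (β : L ≃o B) : List (Ty L B) → L × B → L → Tm L B → Ty L B → Prop
  | var {Γ : List (Ty L B)} {P : L × B} {Q : L} {n : ℕ} {s : Ty L B} :
      Γ[n]? = some s → HasType β Γ P Q (.var n) s
  | unit {Γ : List (Ty L B)} {P : L × B} {Q : L} : HasType β Γ P Q .unit .unit
  | abs {Γ : List (Ty L B)} {P : L × B} {Q : L} {e : Tm L B} {s t : Ty L B} :
      HasType β (s :: Γ) P Q e t → HasType β Γ P Q (.abs e) (.arr s t)
  | app {Γ : List (Ty L B)} {P : L × B} {Q : L} {e a : Tm L B} {s t : Ty L B} :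
      HasType β Γ P Q e (.arr s t) → HasType β Γ P Q a s → HasType β Γ P Q (.app e a) t
  | pair {Γ : List (Ty L B)} {P : L × B} {Q : L} {e₁ e₂ : Tm L B} {s t : Ty L B} :
      HasType β Γ P Q e₁ s → HasType β Γ P Q e₂ t →
      HasType β Γ P Q (.pair e₁ e₂) (.prod s t)
  | proj {Γ : List (Ty L B)} {P : L × B} {Q : L} {e : Tm L B} {s t : Ty L B} (k : Bool) :
      HasType β Γ P Q e (.prod s t) → HasType β Γ P Q (.proj k e) (pick k s t)
  | inj {Γ : List (Ty L B)} {P : L × B} {Q : L} {e : Tm L B} {s t : Ty L B} (k : Bool) :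
      HasType β Γ P Q e (pick k s t) → HasType β Γ P Q (.inj k e) (.sum s t)
  | case {Γ : List (Ty L B)} {P : L × B} {Q : L} {e e₁ e₂ : Tm L B} {s₁ s₂ t : Ty L B} {l : L} :
      HasType β Γ P Q e (.opn (.sum s₁ s₂) l) →
      HasType β (.opn s₁ l :: Γ) P Q e₁ t → HasType β (.opn s₂ l :: Γ) P Q e₂ t →
      HasType β Γ P Q (.case e e₁ e₂) t
  | ret {Γ : List (Ty L B)} {P : L × B} {Q : L} {e : Tm L B} {s : Ty L B} {i : Label L B} :
      HasType β Γ (P ⊔ i.pos) (Q ⊔ i.pos.1) e s → HasType β Γ P Q (.ret i e) (.mon i s)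
  | wret {Γ : List (Ty L B)} {P : L × B} {Q : L} {e : Tm L B} {s : Ty L B} {l : L} :
      HasType β Γ P (Q ⊔ l) e s → HasType β Γ P Q (.wret l e) (.wmon l s)
  | bind {Γ : List (Ty L B)} {P : L × B} {Q : L} {e a : Tm L B} {s t : Ty L B}
      {i : Label L B} :
      HasType β Γ P Q e (.mon i s) → HasType β (s :: Γ) P Q a t →
      (i.pos ≤ P ∨ Prot i t) → HasType β Γ P Q (.bind e a) t
  | wbind {Γ : List (Ty L B)} {P : L × B} {Q : L} {e a : Tm L B} {s t : Ty L B} {l : L} :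
      HasType β Γ P Q e (.wmon l s) → HasType β (.opn s l :: Γ) P Q a t →
      (l ≤ Q ∨ WProt l t) → HasType β Γ P Q (.bind e a) t
  | weaken {Γ : List (Ty L B)} {P : L × B} {Q : L} {e : Tm L B} {s : Ty L B} {l : L} :
      HasType β Γ P Q e (.mon (.level l) s) →
      HasType β Γ P Q (.weaken e) (.mon (.blame (β l)) (.wmon l s))
  | conv {Γ : List (Ty L B)} {P : L × B} {Q : L} {e : Tm L B} {s t : Ty L B} :
      HasType β Γ P Q e s → TyEq s t → HasType β Γ P Q e t
  | taint {Γ : List (Ty L B)} {P : L × B} {Q : L} {e : Tm L B} {s : Ty L B} {l : L} :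
      HasType β Γ P Q e s → HasType β Γ P Q (.taint l e) (.opn s l)

/-- `⊢ e : t`, for closed `e`: no variables, and both protection contexts are bottom. -/
def Typed (β : L ≃o B) (e : Tm L B) (t : Ty L B) : Prop :=
  HasType β [] ⊥ ⊥ e t

/-- The simply typed discipline underlying `HasType`: protection contexts, side conditions and
qualifiers are disregarded. Unlike `HasType`, it is preserved by evaluation. -/
inductive SimplyTyped (β : L ≃o B) : List (Ty L B) → Tm L B → Ty L B → Prop
  | var {Γ : List (Ty L B)} {n : ℕ} {s : Ty L B} :
      Γ[n]? = some s → SimplyTyped β Γ (.var n) s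
  | unit {Γ : List (Ty L B)} : SimplyTyped β Γ .unit .unit
  | abs {Γ : List (Ty L B)} {e : Tm L B} {s t : Ty L B} :
      SimplyTyped β (s :: Γ) e t → SimplyTyped β Γ (.abs e) (.arr s t)
  | app {Γ : List (Ty L B)} {e a : Tm L B} {s t : Ty L B} :
      SimplyTyped β Γ e (.arr s t) → SimplyTyped β Γ a s → SimplyTyped β Γ (.app e a) t
  | pair {Γ : List (Ty L B)} {e₁ e₂ : Tm L B} {s t : Ty L B} :
      SimplyTyped β Γ e₁ s → SimplyTyped β Γ e₂ t →
      SimplyTyped β Γ (.pair e₁ e₂) (.prod s t)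
  | proj {Γ : List (Ty L B)} {e : Tm L B} {s t : Ty L B} (k : Bool) :
      SimplyTyped β Γ e (.prod s t) → SimplyTyped β Γ (.proj k e) (pick k s t)
  | inj {Γ : List (Ty L B)} {e : Tm L B} {s t : Ty L B} (k : Bool) :
      SimplyTyped β Γ e (pick k s t) → SimplyTyped β Γ (.inj k e) (.sum s t)
  | case {Γ : List (Ty L B)} {e e₁ e₂ : Tm L B} {s₁ s₂ t : Ty L B} :
      SimplyTyped β Γ e (.sum s₁ s₂) →
      SimplyTyped β (s₁ :: Γ) e₁ t → SimplyTyped β (s₂ :: Γ) e₂ t →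
      SimplyTyped β Γ (.case e e₁ e₂) t
  | ret {Γ : List (Ty L B)} {e : Tm L B} {s : Ty L B} {i : Label L B} :
      SimplyTyped β Γ e s → SimplyTyped β Γ (.ret i e) (.mon i s)
  | wret {Γ : List (Ty L B)} {e : Tm L B} {s : Ty L B} {l : L} :
      SimplyTyped β Γ e s → SimplyTyped β Γ (.wret l e) (.wmon l s)
  | bind {Γ : List (Ty L B)} {e a : Tm L B} {s t : Ty L B} {i : Label L B} :
      SimplyTyped β Γ e (.mon i s) → SimplyTyped β (s :: Γ) a t →
      SimplyTyped β Γ (.bind e a) t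
  | wbind {Γ : List (Ty L B)} {e a : Tm L B} {s t : Ty L B} {l : L} :
      SimplyTyped β Γ e (.wmon l s) → SimplyTyped β (s :: Γ) a t →
      SimplyTyped β Γ (.bind e a) t
  | weaken {Γ : List (Ty L B)} {e : Tm L B} {s : Ty L B} {l : L} :
      SimplyTyped β Γ e (.mon (.level l) s) →
      SimplyTyped β Γ (.weaken e) (.mon (.blame (β l)) (.wmon l s))
  | taint {Γ : List (Ty L B)} {e : Tm L B} {s : Ty L B} {l : L} :
      SimplyTyped β Γ e s → SimplyTyped β Γ (.taint l e) s

/-- `e` is a closed term whose underlying simple type is that of `t`. These are the terms that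
the relations below compare at type `t`. -/
def OfType (β : L ≃o B) (e : Tm L B) (t : Ty L B) : Prop :=
  SimplyTyped β [] e t.erase

/-- Call-by-name reduction with taint propagation. The equations over tainted terms are
oriented so that only injections stay tainted. -/
inductive Step (β : L ≃o B) : Tm L B → Tm L B → Prop
  | beta (e a : Tm L B) : Step β (.app (.abs e) a) (e.inst a)
  | proj_pair (k : Bool) (e₁ e₂ : Tm L B) : Step β (.proj k (.pair e₁ e₂)) (pick k e₁ e₂)
  | case_inj (k : Bool) (e e₁ e₂ : Tm L B) :
      Step β (.case (.inj k e) e₁ e₂) ((pick k e₁ e₂).inst e)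
  | case_taint (k : Bool) (l : L) (e e₁ e₂ : Tm L B) :
      Step β (.case (.taint l (.inj k e)) e₁ e₂) ((pick k e₁ e₂).inst (.taint l e))
  | bind_ret (i : Label L B) (e a : Tm L B) : Step β (.bind (.ret i e) a) (a.inst e)
  | bind_wret (l : L) (e a : Tm L B) :
      Step β (.bind (.wret l e) a) (a.inst (.taint l e))
  | weaken_ret (l : L) (e : Tm L B) :
      Step β (.weaken (.ret (.level l) e)) (.ret (.blame (β l)) (.wret l e))
  | taint_unit (l : L) : Step β (.taint l .unit) .unit
  | taint_abs (l : L) (e : Tm L B) : Step β (.taint l (.abs e)) (.abs (.taint l e))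
  | taint_pair (l : L) (e₁ e₂ : Tm L B) :
      Step β (.taint l (.pair e₁ e₂)) (.pair (.taint l e₁) (.taint l e₂))
  | taint_taint (l l' : L) (k : Bool) (e : Tm L B) :
      Step β (.taint l' (.taint l (.inj k e))) (.taint (l ⊔ l') (.inj k e))
  | taint_wret_drop {l l' : L} (e : Tm L B) : l ≤ l' →
      Step β (.taint l (.wret l' e)) (.wret l' e)
  | taint_wret {l l' : L} (e : Tm L B) : ¬ l ≤ l' →
      Step β (.taint l (.wret l' e)) (.wret l' (.taint l e))
  | taint_ret_drop {l : L} {i : Label L B} (e : Tm L B) : l ≤ i.pos.1 →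
      Step β (.taint l (.ret i e)) (.ret i e)
  | taint_ret {l : L} {i : Label L B} (e : Tm L B) : ¬ l ≤ i.pos.1 →
      Step β (.taint l (.ret i e)) (.ret i (.taint l e))
  | app_left {e r : Tm L B} (a : Tm L B) : Step β e r → Step β (.app e a) (.app r a)
  | proj_arg (k : Bool) {e r : Tm L B} : Step β e r → Step β (.proj k e) (.proj k r)
  | case_arg {e r : Tm L B} (e₁ e₂ : Tm L B) : Step β e r →
      Step β (.case e e₁ e₂) (.case r e₁ e₂)
  | bind_arg {e r : Tm L B} (a : Tm L B) : Step β e r → Step β (.bind e a) (.bind r a)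
  | weaken_arg {e r : Tm L B} : Step β e r → Step β (.weaken e) (.weaken r)
  | taint_arg (l : L) {e r : Tm L B} : Step β e r → Step β (.taint l e) (.taint l r)

/-- `e ⟶* r`. -/
def Evals (β : L ≃o B) : Tm L B → Tm L B → Prop :=
  Relation.ReflTransGen (Step β)

/-- Values: the introduction forms, where an injection may carry a taint. -/
inductive IsValue : Tm L B → Prop
  | unit : IsValue .unit
  | abs (e : Tm L B) : IsValue (.abs e)
  | pair (e₁ e₂ : Tm L B) : IsValue (.pair e₁ e₂)
  | inj (k : Bool) (e : Tm L B) : IsValue (.inj k e)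
  | taint_inj (l : L) (k : Bool) (e : Tm L B) : IsValue (.taint l (.inj k e))
  | ret (i : Label L B) (e : Tm L B) : IsValue (.ret i e)
  | wret (l : L) (e : Tm L B) : IsValue (.wret l e)

/-- `e` evaluates to `(inj_k r)^ℓ`; an untainted injection is one with taint `⊥`. -/
def EvalsInj (β : L ≃o B) (e : Tm L B) (l : L) (k : Bool) (r : Tm L B) : Prop :=
  Evals β e (.taint l (.inj k r)) ∨ (l = ⊥ ∧ Evals β e (.inj k r))

/-- Indistinguishability `e ~ e' : t` for an observer `o = (ℓ', δ)` that can open data protected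
at levels below `ℓ'` and at blames below `δ`. Taints and qualifiers, which only serve
the safety relation, are ignored, and a weak protection type hides nothing. -/
def Indist (β : L ≃o B) (o : L × B) : Ty L B → Tm L B → Tm L B → Prop
  | .unit, e, e' => Evals β e .unit ∧ Evals β e' .unit
  | .arr s t, e, e' => ∃ b b' : Tm L B, Evals β e (.abs b) ∧ Evals β e' (.abs b') ∧
      ∀ a a' : Tm L B, OfType β a s → OfType β a' s → Indist β o s a a' →
        Indist β o t (.app (.abs b) a) (.app (.abs b') a')
  | .prod s t, e, e' => ∃ e₁ e₂ e₁' e₂' : Tm L B,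
      Evals β e (.pair e₁ e₂) ∧ Evals β e' (.pair e₁' e₂') ∧
      Indist β o s e₁ e₁' ∧ Indist β o t e₂ e₂'
  | .sum s t, e, e' => ∃ (l l' : L) (k : Bool) (r r' : Tm L B),
      EvalsInj β e l k r ∧ EvalsInj β e' l' k r' ∧
      pick k (Indist β o s r r') (Indist β o t r r')
  | .mon i s, e, e' => ∃ r r' : Tm L B, Evals β e (.ret i r) ∧ Evals β e' (.ret i r') ∧
      (¬ i.pos ≤ o ∨ Indist β o s r r')
  | .wmon l s, e, e' => ∃ r r' : Tm L B, Evals β e (.wret l r) ∧ Evals β e' (.wret l r') ∧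
      Indist β o s r r'
  | .opn s _, e, e' => Indist β o s e e'

/-- Safety `e ▷ : t` for an observer `o = (ℓ', δ)`. The data of a sum type must not carry a
taint that is not below `ℓ'`, and an open type `s^ℓ` makes no demand on the data if `ℓ` is not
below `ℓ'`. -/
def Safe (β : L ≃o B) (o : L × B) : Ty L B → Tm L B → Prop
  | .unit, e => Evals β e .unit
  | .arr s t, e => ∃ b : Tm L B, Evals β e (.abs b) ∧
      ∀ a : Tm L B, OfType β a s → Safe β o s a → Safe β o t (.app (.abs b) a)
  | .prod s t, e => ∃ e₁ e₂ : Tm L B, Evals β e (.pair e₁ e₂) ∧ Safe β o s e₁ ∧ Safe β o t e₂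
  | .sum s t, e => ∃ (l : L) (k : Bool) (r : Tm L B), EvalsInj β e l k r ∧ l ≤ o.1 ∧
      pick k (Safe β o s r) (Safe β o t r)
  | .mon i s, e => ∃ r : Tm L B, Evals β e (.ret i r) ∧ (¬ i.pos ≤ o ∨ Safe β o s r)
  | .wmon l s, e => ∃ r : Tm L B, Evals β e (.wret l r) ∧ (¬ l ≤ o.1 ∨ Safe β o s r)
  | .opn s l, e => (¬ l ≤ o.1 ∧ ∃ w : Tm L B, IsValue w ∧ Evals β e w) ∨ Safe β o s e

end System

end DCC

/-! Both parts are instances of a fundamental theorem for a logical relation: under related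
substitutions, a typed term whose context `P` lies below the observer `o` yields related terms
(`HasType.safe`, unary, and `HasType.indist`, binary). The secret argument is related to itself or
to its alternative for free, since the observer cannot open its outer constructor; applying the
self-related function finishes the proof.

The relations demand values even where they hide data, so termination is needed. It is obtained from
the same safety relation: at the observer `⊤` nothing is hidden, and `SimplyTyped.safe_top` is
Tait's reducibility argument. Restricting function arguments to simply typed terms makes termination
available throughout. Consequently, a type protected at an index invisible to `o` relates all its
simply typed terms (`OfType.safe_of_prot`, `OfType.indist_of_prot`); this settles a `bind` on
invisible data.

Open types are transparent for indistinguishability, so conversion is immediate there. For safety,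
`TyEq.safe_iff` splits on whether the qualifier is visible: if so it can be ignored, otherwise both
sides of each qualifier equation hold by termination.

`weaken` turns level protection into blame protection. For indistinguishability this needs `o.2 ≤ β
o.1`: whoever opens `β l` could already open `l`. An arbitrary `δ` in part (1) is first cut down to
`δ ⊓ t.blames` by `indist_inf_iff`. For safety no such bound is needed, because the inner weak
protection type hides the data by its level. -/

namespace DCC

universe u v

/-! ### Substitution calculus for de Bruijn terms. -/

section Substitution

variable {L : Type u} {B : Type v}

/-- The substitution that maps the variable `0` to `a` and the others according to `σ`. -/
def scons (a : Tm L B) (σ : ℕ → Tm L B) : ℕ → Tm L B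
  | 0 => a
  | n + 1 => σ n

theorem liftRen_comp (ρ ρ' : ℕ → ℕ) : liftRen ρ' ∘ liftRen ρ = liftRen (ρ' ∘ ρ) := by
  funext n; cases n <;> rfl

theorem Tm.rename_rename (e : Tm L B) (ρ ρ' : ℕ → ℕ) :
    (e.rename ρ).rename ρ' = e.rename (ρ' ∘ ρ) := by
  induction e generalizing ρ ρ' <;> simp_all [Tm.rename, liftRen_comp]

theorem liftSub_comp_liftRen (ρ : ℕ → ℕ) (σ : ℕ → Tm L B) :
    liftSub σ ∘ liftRen ρ = liftSub (σ ∘ ρ) := by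
  funext n; cases n <;> rfl

theorem Tm.subst_rename (e : Tm L B) (ρ : ℕ → ℕ) (σ : ℕ → Tm L B) :
    (e.rename ρ).subst σ = e.subst (σ ∘ ρ) := by
  induction e generalizing ρ σ <;> simp_all [Tm.rename, Tm.subst, liftSub_comp_liftRen]

theorem liftSub_rename (ρ : ℕ → ℕ) (σ : ℕ → Tm L B) :
    (fun n => (liftSub σ n).rename (liftRen ρ)) = liftSub fun n => (σ n).rename ρ := by
  funext n
  cases n with
  | zero => rfl
  | succ n => simp only [liftSub, Tm.rename_rename]; rfl

theorem Tm.rename_subst (e : Tm L B) (ρ : ℕ → ℕ) (σ : ℕ → Tm L B) :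
    (e.subst σ).rename ρ = e.subst fun n => (σ n).rename ρ := by
  induction e generalizing ρ σ <;> simp_all [Tm.rename, Tm.subst, liftSub_rename]

theorem liftSub_subst (σ τ : ℕ → Tm L B) :
    (fun n => (liftSub σ n).subst (liftSub τ)) = liftSub fun n => (σ n).subst τ := by
  funext n
  cases n with
  | zero => rfl
  | succ n => simp only [liftSub, Tm.subst_rename, Tm.rename_subst]; rfl

theorem Tm.subst_subst (e : Tm L B) (σ τ : ℕ → Tm L B) :
    (e.subst σ).subst τ = e.subst fun n => (σ n).subst τ := by
  induction e generalizing σ τ <;> simp_all [Tm.subst, liftSub_subst]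

theorem liftSub_var : liftSub (Tm.var : ℕ → Tm L B) = Tm.var := by
  funext n; cases n <;> rfl

theorem Tm.subst_var (e : Tm L B) : e.subst Tm.var = e := by
  induction e <;> simp_all [Tm.subst, liftSub_var]

theorem Tm.inst_eq (e a : Tm L B) : e.inst a = e.subst (scons a Tm.var) := by
  unfold Tm.inst
  congr 1

/-- Lets the fundamental theorems treat a contracted binder as the original body under an extended
environment, which is the form of their induction hypotheses. -/
theorem Tm.inst_subst_liftSub (e a : Tm L B) (σ : ℕ → Tm L B) :
    (e.subst (liftSub σ)).inst a = e.subst (scons a σ) := by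
  rw [Tm.inst_eq, Tm.subst_subst]
  congr 1
  funext n
  cases n with
  | zero => rfl
  | succ n => exact (Tm.subst_rename _ _ _).trans (Tm.subst_var _)

theorem forall_getElem?_cons {α : Type*} {p : α → ℕ → Prop} {Γ : List α} {s : α} (h₀ : p s 0)
    (h : ∀ n r, Γ[n]? = some r → p r (n + 1)) : ∀ n r, (s :: Γ)[n]? = some r → p r n
  | 0, r, hr => by
    obtain rfl : s = r := by simpa using hr
    exact h₀
  | n + 1, r, hr => h n r (by simpa using hr)

end Substitution

section System

set_option linter.unusedSectionVars false

variable {L : Type u} {B : Type v} [Lattice L] [BoundedOrder L] [Lattice B] [BoundedOrder B]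
  {β : L ≃o B}

/-! ### Simple typing: substitution, erasure, subject reduction. -/

theorem erase_pick (k : Bool) (s t : Ty L B) : (pick k s t).erase = pick k s.erase t.erase := by
  cases k <;> rfl

theorem SimplyTyped.rename {Γ : List (Ty L B)} {e : Tm L B} {t : Ty L B}
    (h : SimplyTyped β Γ e t) : ∀ {Δ : List (Ty L B)} {ρ : ℕ → ℕ},
    (∀ n s, Γ[n]? = some s → Δ[ρ n]? = some s) → SimplyTyped β Δ (e.rename ρ) t := by
  have lift : ∀ {Γ Δ : List (Ty L B)} {ρ : ℕ → ℕ} (r : Ty L B),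
      (∀ n s, Γ[n]? = some s → Δ[ρ n]? = some s) →
      ∀ n s, (r :: Γ)[n]? = some s → (r :: Δ)[liftRen ρ n]? = some s :=
    fun {Γ Δ ρ} r hρ => forall_getElem?_cons (p := fun s n => (r :: Δ)[liftRen ρ n]? = some s)
      rfl fun n s hs => by simpa [liftRen] using hρ n s hs
  induction h with
  | var h => exact fun hρ => .var (hρ _ _ h)
  | unit => exact fun _ => .unit
  | abs _ ih => exact fun hρ => .abs (ih (lift _ hρ))
  | app _ _ ih₁ ih₂ => exact fun hρ => .app (ih₁ hρ) (ih₂ hρ)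
  | pair _ _ ih₁ ih₂ => exact fun hρ => .pair (ih₁ hρ) (ih₂ hρ)
  | proj k _ ih => exact fun hρ => .proj k (ih hρ)
  | inj k _ ih => exact fun hρ => .inj k (ih hρ)
  | case _ _ _ ih ih₁ ih₂ => exact fun hρ => .case (ih hρ) (ih₁ (lift _ hρ)) (ih₂ (lift _ hρ))
  | ret _ ih => exact fun hρ => .ret (ih hρ)
  | wret _ ih => exact fun hρ => .wret (ih hρ)
  | bind _ _ ih₁ ih₂ => exact fun hρ => .bind (ih₁ hρ) (ih₂ (lift _ hρ))
  | wbind _ _ ih₁ ih₂ => exact fun hρ => .wbind (ih₁ hρ) (ih₂ (lift _ hρ))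
  | weaken _ ih => exact fun hρ => .weaken (ih hρ)
  | taint _ ih => exact fun hρ => .taint (ih hρ)

theorem SimplyTyped.subst {Γ : List (Ty L B)} {e : Tm L B} {t : Ty L B}
    (h : SimplyTyped β Γ e t) : ∀ {Δ : List (Ty L B)} {σ : ℕ → Tm L B},
    (∀ n s, Γ[n]? = some s → SimplyTyped β Δ (σ n) s) → SimplyTyped β Δ (e.subst σ) t := by
  have lift : ∀ {Γ Δ : List (Ty L B)} {σ : ℕ → Tm L B} (r : Ty L B),
      (∀ n s, Γ[n]? = some s → SimplyTyped β Δ (σ n) s) →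
      ∀ n s, (r :: Γ)[n]? = some s → SimplyTyped β (r :: Δ) (liftSub σ n) s :=
    fun {Γ Δ σ} r hσ => forall_getElem?_cons
      (p := fun s n => SimplyTyped β (r :: Δ) (liftSub σ n) s)
      (.var rfl) fun n s hs => (hσ n s hs).rename fun n s hs => by simpa using hs
  induction h with
  | var h => exact fun hσ => hσ _ _ h
  | unit => exact fun _ => .unit
  | abs _ ih => exact fun hσ => .abs (ih (lift _ hσ))
  | app _ _ ih₁ ih₂ => exact fun hσ => .app (ih₁ hσ) (ih₂ hσ)
  | pair _ _ ih₁ ih₂ => exact fun hσ => .pair (ih₁ hσ) (ih₂ hσ)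
  | proj k _ ih => exact fun hσ => .proj k (ih hσ)
  | inj k _ ih => exact fun hσ => .inj k (ih hσ)
  | case _ _ _ ih ih₁ ih₂ => exact fun hσ => .case (ih hσ) (ih₁ (lift _ hσ)) (ih₂ (lift _ hσ))
  | ret _ ih => exact fun hσ => .ret (ih hσ)
  | wret _ ih => exact fun hσ => .wret (ih hσ)
  | bind _ _ ih₁ ih₂ => exact fun hσ => .bind (ih₁ hσ) (ih₂ (lift _ hσ))
  | wbind _ _ ih₁ ih₂ => exact fun hσ => .wbind (ih₁ hσ) (ih₂ (lift _ hσ))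
  | weaken _ ih => exact fun hσ => .weaken (ih hσ)
  | taint _ ih => exact fun hσ => .taint (ih hσ)

theorem SimplyTyped.inst {Γ : List (Ty L B)} {e a : Tm L B} {s t : Ty L B}
    (h : SimplyTyped β (s :: Γ) e t) (ha : SimplyTyped β Γ a s) :
    SimplyTyped β Γ (e.inst a) t := by
  rw [Tm.inst_eq]
  exact h.subst (forall_getElem?_cons (p := fun r n => SimplyTyped β Γ (scons a Tm.var n) r)
    ha fun n r hr => .var hr)

theorem SimplyTyped.erase {Γ : List (Ty L B)} {e : Tm L B} {t : Ty L B}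
    (h : SimplyTyped β Γ e t) : SimplyTyped β (Γ.map Ty.erase) e t.erase := by
  induction h with
  | var h => exact .var (by simp [h])
  | unit => exact .unit
  | abs _ ih => exact .abs ih
  | app _ _ ih₁ ih₂ => exact .app ih₁ ih₂
  | pair _ _ ih₁ ih₂ => exact .pair ih₁ ih₂
  | proj k _ ih => rw [erase_pick]; exact .proj k ih
  | inj k _ ih => rw [erase_pick] at ih; exact .inj k ih
  | case _ _ _ ih ih₁ ih₂ => exact .case ih ih₁ ih₂
  | ret _ ih => exact .ret ih
  | wret _ ih => exact .wret ih
  | bind _ _ ih₁ ih₂ => exact .bind ih₁ ih₂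
  | wbind _ _ ih₁ ih₂ => exact .wbind ih₁ ih₂
  | weaken _ ih => exact .weaken ih
  | taint _ ih => exact .taint ih

theorem TyEq.erase_eq {s t : Ty L B} (h : TyEq s t) : s.erase = t.erase := by
  induction h <;> simp_all [Ty.erase]

/-- Conversion disappears because equal types have the same erasure. This is how typed terms enter
the domain of the relations. -/
theorem HasType.simplyTyped {Γ : List (Ty L B)} {P : L × B} {Q : L} {e : Tm L B} {t : Ty L B}
    (h : HasType β Γ P Q e t) : SimplyTyped β (Γ.map Ty.erase) e t.erase := by
  induction h with
  | var h => exact .var (by simp [h])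
  | unit => exact .unit
  | abs _ ih => exact .abs ih
  | app _ _ ih₁ ih₂ => exact .app ih₁ ih₂
  | pair _ _ ih₁ ih₂ => exact .pair ih₁ ih₂
  | proj k _ ih => rw [erase_pick]; exact .proj k ih
  | inj k _ ih => rw [erase_pick] at ih; exact .inj k ih
  | case _ _ _ ih ih₁ ih₂ => exact .case ih ih₁ ih₂
  | ret _ ih => exact .ret ih
  | wret _ ih => exact .wret ih
  | bind _ _ _ ih₁ ih₂ => exact .bind ih₁ ih₂
  | wbind _ _ _ ih₁ ih₂ => exact .wbind ih₁ ih₂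
  | weaken _ ih => exact .weaken ih
  | conv _ h ih => exact h.erase_eq ▸ ih
  | taint _ ih => exact .taint ih

theorem SimplyTyped.step {Γ : List (Ty L B)} {e r : Tm L B} (h : Step β e r) :
    ∀ {t : Ty L B}, SimplyTyped β Γ e t → SimplyTyped β Γ r t := by
  induction h with
  | beta e a =>
    intro t h; cases h with | app h ha => cases h with | abs h => exact h.inst ha
  | proj_pair k e₁ e₂ => intro t h; cases h with | proj k h => cases h; cases k <;> assumption
  | case_inj k e e₁ e₂ =>
    intro t h
    cases h with | case h h₁ h₂ => cases h with | inj _ h =>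
    cases k
    exacts [h₂.inst h, h₁.inst h]
  | case_taint k l e e₁ e₂ =>
    intro t h
    cases h with | case h h₁ h₂ => cases h with | taint h => cases h with | inj _ h =>
    cases k
    exacts [h₂.inst (.taint h), h₁.inst (.taint h)]
  | bind_ret i e a =>
    intro t h
    cases h with
    | bind h ha => cases h with | ret h => exact ha.inst h
    -- `bind` has two typing rules; the constructor of the scrutinee rules one out.
    | wbind h => cases h
  | bind_wret i e a =>
    intro t h
    cases h with
    | bind h => cases h
    | wbind h ha => cases h with | wret h => exact ha.inst (.taint h)
  | weaken_ret l e =>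
    intro t h
    cases h with | weaken h => cases h with | ret h => exact .ret (.wret h)
  | taint_unit l => intro t h; cases h with | taint h => exact h
  | taint_abs l e =>
    intro t h; cases h with | taint h => cases h with | abs h => exact .abs (.taint h)
  | taint_pair l e₁ e₂ =>
    intro t h
    cases h with | taint h => cases h with | pair h₁ h₂ => exact .pair (.taint h₁) (.taint h₂)
  | taint_taint l l' k e =>
    intro t h; cases h with | taint h => cases h with | taint h => exact .taint h
  | taint_wret_drop e _ => intro t h; cases h with | taint h => exact h
  | taint_wret e _ =>
    intro t h; cases h with | taint h => cases h with | wret h => exact .wret (.taint h)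
  | taint_ret_drop e _ => intro t h; cases h with | taint h => exact h
  | taint_ret e _ =>
    intro t h; cases h with | taint h => cases h with | ret h => exact .ret (.taint h)
  | app_left a _ ih => intro t h; cases h with | app h₁ h₂ => exact .app (ih h₁) h₂
  | proj_arg k _ ih => intro t h; cases h with | proj k h => exact .proj k (ih h)
  | case_arg e₁ e₂ _ ih => intro t h; cases h with | case h h₁ h₂ => exact .case (ih h) h₁ h₂
  | bind_arg a _ ih =>
    intro t h
    cases h with
    | bind h h' => exact .bind (ih h) h'
    | wbind h h' => exact .wbind (ih h) h'
  | weaken_arg _ ih => intro t h; cases h with | weaken h => exact .weaken (ih h)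
  | taint_arg l _ ih => intro t h; cases h with | taint h => exact .taint (ih h)

/-! ### Determinism of evaluation and propagation of taints. -/

section Evaluation

theorem IsValue.not_step {v r : Tm L B} (hv : IsValue v) : ¬ Step β v r := by
  intro h
  cases hv with
  | taint_inj => cases h with | taint_arg _ h => cases h
  | _ => cases h

/-- A congruence rule could only compete with a contraction whose principal argument is a value, and
values do not step. The side conditions of the dropping and pushing rules for taints exclude each
other. -/
theorem Step.deterministic {e r r' : Tm L B} (h : Step β e r) (h' : Step β e r') : r = r' := by
  induction h generalizing r' with
  | app_left a h ih => cases h' with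
    | beta => cases h
    | app_left _ h' => rw [ih h']
  | proj_arg k h ih => cases h' with
    | proj_pair => cases h
    | proj_arg _ h' => rw [ih h']
  | case_arg _ _ h ih => cases h' with
    | case_inj => cases h
    | case_taint => exact absurd h (IsValue.taint_inj _ _ _).not_step
    | case_arg _ _ h' => rw [ih h']
  | bind_arg a h ih => cases h' with
    | bind_ret => cases h
    | bind_wret => cases h
    | bind_arg _ h' => rw [ih h']
  | weaken_arg h ih => cases h' with
    | weaken_ret => cases h
    | weaken_arg h' => rw [ih h']
  | taint_arg l h ih => cases h' with
    | taint_arg _ h' => rw [ih h']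
    | taint_taint => exact absurd h (IsValue.taint_inj _ _ _).not_step
    | _ => cases h
  | case_taint => cases h' with
    | case_taint => rfl
    | case_arg _ _ h => exact absurd h (IsValue.taint_inj _ _ _).not_step
  | taint_taint => cases h' with
    | taint_taint => rfl
    | taint_arg _ h => exact absurd h (IsValue.taint_inj _ _ _).not_step
  | _ => cases h' <;> first | rfl | contradiction

theorem Evals.of_value {e r v : Tm L B} (h : Evals β e r) (hv : IsValue v) (h' : Evals β e v) :
    Evals β r v := by
  induction h using Relation.ReflTransGen.head_induction_on with
  | refl => exact h'
  | head h _ ih =>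
    rcases Relation.ReflTransGen.cases_head h' with rfl | ⟨c, hc, h'⟩
    · exact absurd h hv.not_step
    · exact ih (h.deterministic hc ▸ h')

theorem evals_iff {e r v : Tm L B} (h : Evals β e r) (hv : IsValue v) :
    Evals β e v ↔ Evals β r v :=
  ⟨h.of_value hv, h.trans⟩

theorem evalsInj_iff {e r a : Tm L B} {l : L} {k : Bool} (h : Evals β e r) :
    EvalsInj β e l k a ↔ EvalsInj β r l k a := by
  simp only [EvalsInj, evals_iff h (.taint_inj _ _ _), evals_iff h (.inj _ _)]

theorem Evals.app {e r : Tm L B} (a : Tm L B) (h : Evals β e r) :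
    Evals β (.app e a) (.app r a) :=
  Relation.ReflTransGen.lift (fun x => Tm.app x a) (fun _ _ => Step.app_left a) _ _ h

theorem Evals.proj {e r : Tm L B} (k : Bool) (h : Evals β e r) :
    Evals β (.proj k e) (.proj k r) :=
  Relation.ReflTransGen.lift (Tm.proj k) (fun _ _ => Step.proj_arg k) _ _ h

theorem Evals.case {e r : Tm L B} (e₁ e₂ : Tm L B) (h : Evals β e r) :
    Evals β (.case e e₁ e₂) (.case r e₁ e₂) :=
  Relation.ReflTransGen.lift (fun x => Tm.case x e₁ e₂) (fun _ _ => Step.case_arg e₁ e₂) _ _ h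

theorem Evals.bind {e r : Tm L B} (a : Tm L B) (h : Evals β e r) :
    Evals β (.bind e a) (.bind r a) :=
  Relation.ReflTransGen.lift (fun x => Tm.bind x a) (fun _ _ => Step.bind_arg a) _ _ h

theorem Evals.weaken {e r : Tm L B} (h : Evals β e r) : Evals β (.weaken e) (.weaken r) :=
  Relation.ReflTransGen.lift Tm.weaken (fun _ _ => Step.weaken_arg) _ _ h

theorem Evals.taint {e r : Tm L B} (l : L) (h : Evals β e r) :
    Evals β (.taint l e) (.taint l r) :=
  Relation.ReflTransGen.lift (Tm.taint l) (fun _ _ => Step.taint_arg l) _ _ h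

/-- The branch receives the payload tainted or bare, according to the form of the injection;
relations closed under tainting need not know which. -/
theorem EvalsInj.case {e r : Tm L B} {l : L} {k : Bool} (h : EvalsInj β e l k r)
    (e₁ e₂ : Tm L B) : ∃ r', (r' = r ∨ r' = .taint l r) ∧
      Evals β (.case e e₁ e₂) ((pick k e₁ e₂).inst r') := by
  rcases h with h | ⟨_, h⟩
  · exact ⟨_, .inr rfl, (h.case e₁ e₂).tail (.case_taint _ _ _ _ _)⟩
  · exact ⟨_, .inl rfl, (h.case e₁ e₂).tail (.case_inj _ _ _ _)⟩

theorem EvalsInj.taint {e r : Tm L B} {l : L} {k : Bool} (h : EvalsInj β e l k r) (l' : L) :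
    EvalsInj β (.taint l' e) (l ⊔ l') k r := by
  rcases h with h | ⟨rfl, h⟩
  · exact .inl ((h.taint l').tail (.taint_taint _ _ _ _))
  · rw [bot_sup_eq]; exact .inl (h.taint l')

/-- Hides whether the taint is dropped or pushed inside. -/
theorem Evals.taint_ret {e r : Tm L B} {i : Label L B} (h : Evals β e (.ret i r)) (l : L) :
    ∃ r', (r' = r ∨ r' = .taint l r) ∧ Evals β (.taint l e) (.ret i r') := by
  by_cases hl : l ≤ i.pos.1
  · exact ⟨_, .inl rfl, (h.taint l).tail (.taint_ret_drop _ hl)⟩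
  · exact ⟨_, .inr rfl, (h.taint l).tail (.taint_ret _ hl)⟩

theorem Evals.taint_wret {e r : Tm L B} {l' : L} (h : Evals β e (.wret l' r)) (l : L) :
    ∃ r', (r' = r ∨ r' = .taint l r) ∧ Evals β (.taint l e) (.wret l' r') := by
  by_cases hl : l ≤ l'
  · exact ⟨_, .inl rfl, (h.taint l).tail (.taint_wret_drop _ hl)⟩
  · exact ⟨_, .inr rfl, (h.taint l).tail (.taint_wret _ hl)⟩

theorem Evals.exists_value_taint {e w : Tm L B} (hw : IsValue w) (h : Evals β e w) (l : L) :
    ∃ w', IsValue w' ∧ Evals β (.taint l e) w' := by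
  cases hw with
  | unit => exact ⟨_, .unit, (h.taint l).tail (.taint_unit l)⟩
  | abs => exact ⟨_, .abs _, (h.taint l).tail (.taint_abs l _)⟩
  | pair => exact ⟨_, .pair _ _, (h.taint l).tail (.taint_pair l _ _)⟩
  | inj => exact ⟨_, .taint_inj _ _ _, h.taint l⟩
  | taint_inj => exact ⟨_, .taint_inj _ _ _, (h.taint l).tail (.taint_taint _ _ _ _)⟩
  | ret => obtain ⟨_, _, h⟩ := h.taint_ret l; exact ⟨_, .ret _ _, h⟩
  | wret => obtain ⟨_, _, h⟩ := h.taint_wret l; exact ⟨_, .wret _ _, h⟩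

/-- Together with `evals_taint_app_abs`, this gives a common reduct to tainting a function and
tainting its result, as needed for the arrow case of closure under taints. -/
theorem evals_app_abs_taint (l : L) (b a : Tm L B) :
    Evals β (.app (.abs (.taint l b)) a) (.taint l (b.inst a)) :=
  .single (.beta _ _)

theorem evals_taint_app_abs (l : L) (b a : Tm L B) :
    Evals β (.taint l (.app (.abs b) a)) (.taint l (b.inst a)) :=
  .single (.taint_arg l (.beta _ _))

end Evaluation

/-! ### Simply typed closed terms and the components of their values. -/

section OfType

variable {e r : Tm L B} {s t : Ty L B}

theorem OfType.evals (h : OfType β e t) (he : Evals β e r) : OfType β r t := by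
  induction he with
  | refl => exact h
  | tail _ h ih => exact SimplyTyped.step h ih

theorem OfType.of_ret {i : Label L B} (h : OfType β e (.mon i s)) (he : Evals β e (.ret i r)) :
    OfType β r s := by
  have := h.evals he
  cases this with | ret h => exact h

theorem OfType.of_wret {l : L} (h : OfType β e (.wmon l s)) (he : Evals β e (.wret l r)) :
    OfType β r s := by
  have := h.evals he
  cases this with | wret h => exact h

theorem OfType.of_pair {e₁ e₂ : Tm L B} (h : OfType β e (.prod s t))
    (he : Evals β e (.pair e₁ e₂)) : OfType β e₁ s ∧ OfType β e₂ t := by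
  have := h.evals he
  cases this with | pair h₁ h₂ => exact ⟨h₁, h₂⟩

theorem OfType.of_inj {l : L} {k : Bool} (h : OfType β e (.sum s t))
    (he : EvalsInj β e l k r) : OfType β r (pick k s t) := by
  unfold OfType
  rw [erase_pick]
  rcases he with he | ⟨_, he⟩
  · have := h.evals he
    cases this with | taint h => cases h with | inj _ h => exact h
  · have := h.evals he
    cases this with | inj _ h => exact h

theorem OfType.app {a : Tm L B} (h : OfType β e (.arr s t)) (ha : OfType β a s) :
    OfType β (.app e a) t :=
  SimplyTyped.app h ha

theorem OfType.taint (h : OfType β e t) (l : L) : OfType β (.taint l e) t :=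
  SimplyTyped.taint h

theorem ofType_congr (h : TyEq s t) : OfType β e s ↔ OfType β e t := by
  rw [OfType, OfType, h.erase_eq]

theorem ofType_subst_of_erase {Γ : List (Ty L B)} {σ : ℕ → Tm L B}
    (h : SimplyTyped β (Γ.map Ty.erase) e t.erase)
    (hσ : ∀ n s, Γ[n]? = some s → OfType β (σ n) s) : OfType β (e.subst σ) t := by
  refine h.subst fun n s hs => ?_
  obtain ⟨r, hr, rfl⟩ : ∃ r, Γ[n]? = some r ∧ r.erase = s := by simpa using hs
  exact hσ n r hr

end OfType

/-! ### Safety: closure properties. -/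

section Safe

variable {o : L × B} {e r : Tm L B} {s t : Ty L B}

/-- Safety depends only on the values reached, which determinism makes the same for `e` and `r`. It
serves both as head expansion and as head reduction. -/
theorem safe_iff (h : Evals β e r) : Safe β o t e ↔ Safe β o t r := by
  induction t with
  | unit => simp only [Safe, evals_iff h .unit]
  | arr => simp only [Safe, evals_iff h (.abs _)]
  | prod => simp only [Safe, evals_iff h (.pair _ _)]
  | sum => simp only [Safe, evalsInj_iff h]
  | mon => simp only [Safe, evals_iff h (.ret _ _)]
  | wmon => simp only [Safe, evals_iff h (.wret _ _)]
  | opn s l ih =>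
    simp only [Safe, ih]
    refine or_congr_left (and_congr_right fun _ => exists_congr fun w => ?_)
    exact and_congr_right fun hw => evals_iff h hw

/-- Taints are inspected only at sums, where the join of two visible taints is still visible. -/
theorem Safe.taint {l : L} (hl : l ≤ o.1) (h : Safe β o t e) : Safe β o t (.taint l e) := by
  induction t generalizing e with
  | unit => exact (Evals.taint l h).tail (.taint_unit l)
  | arr s t _ ih =>
    obtain ⟨b, hb, h⟩ := h
    refine ⟨_, (hb.taint l).tail (.taint_abs l b), fun a ha hs => ?_⟩
    have := ih (h a ha hs)
    rw [safe_iff (evals_taint_app_abs l b a)] at this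
    rwa [safe_iff (evals_app_abs_taint l b a)]
  | prod s t ih₁ ih₂ =>
    obtain ⟨e₁, e₂, he, h₁, h₂⟩ := h
    exact ⟨_, _, (he.taint l).tail (.taint_pair l _ _), ih₁ h₁, ih₂ h₂⟩
  | sum s t =>
    obtain ⟨l', k, r, he, hl', h⟩ := h
    exact ⟨_, k, r, he.taint l, sup_le hl' hl, h⟩
  | mon i s ih =>
    obtain ⟨r, he, h⟩ := h
    obtain ⟨r', hr, he⟩ := he.taint_ret l
    refine ⟨r', he, h.imp_right fun h => ?_⟩
    rcases hr with rfl | rfl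
    exacts [h, ih h]
  | wmon l' s ih =>
    obtain ⟨r, he, h⟩ := h
    obtain ⟨r', hr, he⟩ := he.taint_wret l
    refine ⟨r', he, h.imp_right fun h => ?_⟩
    rcases hr with rfl | rfl
    exacts [h, ih h]
  | opn s l' ih =>
    rcases h with ⟨hl', w, hw, h⟩ | h
    · exact .inl ⟨hl', h.exists_value_taint hw l⟩
    · exact .inr (ih h)

theorem Safe.exists_value (h : Safe β o t e) : ∃ w, IsValue w ∧ Evals β e w := by
  induction t with
  | unit => exact ⟨_, .unit, h⟩
  | arr => obtain ⟨_, h, _⟩ := h; exact ⟨_, .abs _, h⟩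
  | prod => obtain ⟨_, _, h, _⟩ := h; exact ⟨_, .pair _ _, h⟩
  | sum =>
    obtain ⟨_, _, _, h | ⟨_, h⟩, _⟩ := h
    exacts [⟨_, .taint_inj _ _ _, h⟩, ⟨_, .inj _ _, h⟩]
  | mon => obtain ⟨_, h, _⟩ := h; exact ⟨_, .ret _ _, h⟩
  | wmon => obtain ⟨_, h, _⟩ := h; exact ⟨_, .wret _ _, h⟩
  | opn s l ih => exact h.elim And.right ih

theorem Safe.app {a : Tm L B} (h : Safe β o (.arr s t) e) (ha : OfType β a s)
    (hs : Safe β o s a) : Safe β o t (.app e a) := by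
  obtain ⟨b, hb, h⟩ := h
  exact (safe_iff (hb.app a)).2 (h a ha hs)

theorem Safe.abs {b : Tm L B} (h : ∀ a, OfType β a s → Safe β o s a → Safe β o t (b.inst a)) :
    Safe β o (.arr s t) (.abs b) :=
  ⟨b, .refl, fun a ha hs => (safe_iff (.single (.beta b a))).2 (h a ha hs)⟩

theorem Safe.proj (k : Bool) (h : Safe β o (.prod s t) e) :
    Safe β o (pick k s t) (.proj k e) := by
  obtain ⟨e₁, e₂, he, h₁, h₂⟩ := h
  refine (safe_iff ((he.proj k).tail (.proj_pair k _ _))).2 ?_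
  cases k
  exacts [h₂, h₁]

theorem Safe.inj {k : Bool} (h : Safe β o (pick k s t) e) : Safe β o (.sum s t) (.inj k e) :=
  ⟨⊥, k, e, .inr ⟨rfl, .refl⟩, bot_le, by cases k <;> exact h⟩

theorem Safe.case {e₁ e₂ : Tm L B} {s₁ s₂ : Ty L B} (he : OfType β e (.sum s₁ s₂))
    (h : Safe β o (.sum s₁ s₂) e)
    (hk : ∀ k r, OfType β r (pick k s₁ s₂) → Safe β o (pick k s₁ s₂) r →
      Safe β o t ((pick k e₁ e₂).inst r)) : Safe β o t (.case e e₁ e₂) := by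
  obtain ⟨l, k, r, hr, hl, h⟩ := h
  have h : Safe β o (pick k s₁ s₂) r := by cases k <;> exact h
  have hT := he.of_inj hr
  obtain ⟨r', hr', hc⟩ := hr.case e₁ e₂
  refine (safe_iff hc).2 ?_
  rcases hr' with rfl | rfl
  exacts [hk _ _ hT h, hk _ _ (hT.taint l) (h.taint hl)]

/-- The blame `β l` may well be visible while `l` is not; the content is safe anyway, since `l` then
hides the data inside the weak protection type. No relation between the two components of `o` is
required. -/
theorem Safe.weaken {l : L} (h : Safe β o (.mon (.level l) s) e) :
    Safe β o (.mon (.blame (β l)) (.wmon l s)) (.weaken e) := by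
  obtain ⟨r, he, h⟩ := h
  refine ⟨_, he.weaken.tail (.weaken_ret l r), .inr ⟨r, .refl, h.imp_left fun h hl => h ?_⟩⟩
  exact ⟨hl, bot_le⟩

/-! ### Termination and its consequences for protected types. -/

/-- Evaluation of simply typed terms terminates; stated as safety for the observer that can
open everything. -/
theorem SimplyTyped.safe_top {Γ : List (Ty L B)} (h : SimplyTyped β Γ e t) :
    ∀ {σ : ℕ → Tm L B},
    (∀ n s, Γ[n]? = some s → OfType β (σ n) s ∧ Safe β ⊤ s (σ n)) →
    Safe β ⊤ t (e.subst σ) := by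
  have cons : ∀ {Γ : List (Ty L B)} {σ : ℕ → Tm L B} {s : Ty L B} {a : Tm L B},
      (∀ n s, Γ[n]? = some s → OfType β (σ n) s ∧ Safe β ⊤ s (σ n)) →
      OfType β a s → Safe β ⊤ s a →
      ∀ n r, (s :: Γ)[n]? = some r → OfType β (scons a σ n) r ∧ Safe β ⊤ r (scons a σ n) :=
    fun {Γ σ s a} hσ ha hs => forall_getElem?_cons
      (p := fun r n => OfType β (scons a σ n) r ∧ Safe β ⊤ r (scons a σ n)) ⟨ha, hs⟩ hσ
  have typed : ∀ {Γ : List (Ty L B)} {e : Tm L B} {t : Ty L B} {σ : ℕ → Tm L B},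
      SimplyTyped β Γ e t →
      (∀ n s, Γ[n]? = some s → OfType β (σ n) s ∧ Safe β ⊤ s (σ n)) →
      OfType β (e.subst σ) t :=
    fun h hσ => ofType_subst_of_erase h.erase fun n s hs => (hσ n s hs).1
  induction h with
  | var h => exact fun hσ => (hσ _ _ h).2
  | unit => exact fun _ => .refl
  | abs _ ih =>
    refine @fun σ hσ => Safe.abs fun a ha hs => ?_
    rw [Tm.inst_subst_liftSub]
    exact ih (cons hσ ha hs)
  | app _ h₂ ih₁ ih₂ => exact fun hσ => (ih₁ hσ).app (typed h₂ hσ) (ih₂ hσ)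
  | pair _ _ ih₁ ih₂ => exact fun hσ => ⟨_, _, .refl, ih₁ hσ, ih₂ hσ⟩
  | proj k _ ih => exact fun hσ => (ih hσ).proj k
  | inj k _ ih => exact fun hσ => (ih hσ).inj
  | case h _ _ ih ih₁ ih₂ =>
    refine @fun σ hσ => (ih hσ).case (typed h hσ) fun k r hr hs => ?_
    cases k
    · simp only [pick, Tm.inst_subst_liftSub]
      exact ih₂ (cons hσ hr hs)
    · simp only [pick, Tm.inst_subst_liftSub]
      exact ih₁ (cons hσ hr hs)
  | ret _ ih => exact fun hσ => ⟨_, .refl, .inr (ih hσ)⟩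
  | wret _ ih => exact fun hσ => ⟨_, .refl, .inr (ih hσ)⟩
  | bind h _ ih₁ ih₂ =>
    intro σ hσ
    obtain ⟨r, he, hr⟩ := ih₁ hσ
    refine (safe_iff ((he.bind _).tail (.bind_ret _ _ _))).2 ?_
    rw [Tm.inst_subst_liftSub]
    -- At the observer `⊤` the alternative of invisible data is void.
    exact ih₂ (cons hσ ((typed h hσ).of_ret he) (hr.resolve_left (not_not_intro le_top)))
  | wbind h _ ih₁ ih₂ =>
    intro σ hσ
    obtain ⟨r, he, hr⟩ := ih₁ hσ
    refine (safe_iff ((he.bind _).tail (.bind_wret _ _ _))).2 ?_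
    rw [Tm.inst_subst_liftSub]
    exact ih₂ (cons hσ (((typed h hσ).of_wret he).taint _)
      ((hr.resolve_left (not_not_intro le_top)).taint le_top))
  | weaken _ ih => exact fun hσ => (ih hσ).weaken
  | taint _ ih => exact fun hσ => (ih hσ).taint le_top

theorem OfType.safe_top (h : OfType β e t) : Safe β ⊤ t.erase e := by
  have := SimplyTyped.safe_top h (σ := Tm.var) (by simp)
  rwa [Tm.subst_var] at this

theorem OfType.exists_value (h : OfType β e t) : ∃ w, IsValue w ∧ Evals β e w :=
  h.safe_top.exists_value

theorem OfType.exists_abs (h : OfType β e (.arr s t)) : ∃ b, Evals β e (.abs b) := by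
  obtain ⟨b, hb, _⟩ := h.safe_top
  exact ⟨b, hb⟩

theorem OfType.exists_pair (h : OfType β e (.prod s t)) :
    ∃ e₁ e₂, Evals β e (.pair e₁ e₂) := by
  obtain ⟨e₁, e₂, he, _⟩ := h.safe_top
  exact ⟨e₁, e₂, he⟩

theorem OfType.exists_inj (h : OfType β e (.sum s t)) : ∃ l k r, EvalsInj β e l k r := by
  obtain ⟨l, k, r, he, _⟩ := h.safe_top
  exact ⟨l, k, r, he⟩

theorem OfType.exists_ret {i : Label L B} (h : OfType β e (.mon i s)) :
    ∃ r, Evals β e (.ret i r) := by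
  obtain ⟨r, he, _⟩ := h.safe_top
  exact ⟨r, he⟩

theorem OfType.exists_wret {l : L} (h : OfType β e (.wmon l s)) :
    ∃ r, Evals β e (.wret l r) := by
  obtain ⟨r, he, _⟩ := h.safe_top
  exact ⟨r, he⟩

/-- Protection ensures that observation stops at `unit` or at some `T_j` with `i ⊑ j`, which is
invisible too. What remains to be shown is termination, so the simple type suffices. -/
theorem OfType.safe_of_prot {i : Label L B} (hi : ¬ i.pos ≤ o) (hp : Prot i t)
    (h : OfType β e t) : Safe β o t e := by
  induction t generalizing e with
  | unit => exact h.safe_top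
  | arr s t _ ih =>
    obtain ⟨b, hb⟩ := h.exists_abs
    exact ⟨b, hb, fun a ha _ => ih hp ((h.evals hb).app ha)⟩
  | prod s t ih₁ ih₂ =>
    obtain ⟨e₁, e₂, he⟩ := h.exists_pair
    have := h.of_pair he
    exact ⟨e₁, e₂, he, ih₁ hp.1 this.1, ih₂ hp.2 this.2⟩
  | sum => exact hp.elim
  | mon j s ih =>
    obtain ⟨r, he⟩ := h.exists_ret
    refine ⟨r, he, hp.imp (fun hij hj => hi (hij.trans hj)) fun hp => ih hp (h.of_ret he)⟩
  | wmon l s ih =>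
    obtain ⟨r, he⟩ := h.exists_wret
    exact ⟨r, he, .inr (ih hp (h.of_wret he))⟩
  | opn => exact hp.elim

theorem OfType.safe_opn {l : L} (hl : ¬ l ≤ o.1) (h : OfType β e s) :
    Safe β o (.opn s l) e :=
  .inl ⟨hl, h.exists_value⟩

/-! ### Safety respects the open type equations. -/

theorem safe_opn_iff {l : L} (hl : l ≤ o.1) : Safe β o (.opn s l) e ↔ Safe β o s e := by
  simp [Safe, hl]

/-- In this and the following congruences, equivalence is assumed only on simply typed terms. The
equations need this: under an invisible qualifier an arbitrary value is safe, whatever its form. -/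
theorem safe_arr_congr {s' t' : Ty L B} (h : OfType β e (.arr s t)) (hs : s.erase = s'.erase)
    (h₁ : ∀ a, OfType β a s → (Safe β o s a ↔ Safe β o s' a))
    (h₂ : ∀ a, OfType β a t → (Safe β o t a ↔ Safe β o t' a)) :
    Safe β o (.arr s t) e ↔ Safe β o (.arr s' t') e := by
  simp only [Safe]
  refine exists_congr fun b => and_congr_right fun hb => forall_congr' fun a => ?_
  rw [show OfType β a s' ↔ OfType β a s by rw [OfType, OfType, hs]]
  refine forall_congr' fun ha => ?_
  rw [h₁ a ha, h₂ _ ((h.evals hb).app ha)]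

theorem safe_prod_congr {s' t' : Ty L B} (h : OfType β e (.prod s t))
    (h₁ : ∀ a, OfType β a s → (Safe β o s a ↔ Safe β o s' a))
    (h₂ : ∀ a, OfType β a t → (Safe β o t a ↔ Safe β o t' a)) :
    Safe β o (.prod s t) e ↔ Safe β o (.prod s' t') e := by
  simp only [Safe]
  refine exists_congr fun e₁ => exists_congr fun e₂ => and_congr_right fun he => ?_
  have := h.of_pair he
  rw [h₁ _ this.1, h₂ _ this.2]

theorem safe_sum_congr {s' t' : Ty L B} (h : OfType β e (.sum s t))
    (h₁ : ∀ a, OfType β a s → (Safe β o s a ↔ Safe β o s' a))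
    (h₂ : ∀ a, OfType β a t → (Safe β o t a ↔ Safe β o t' a)) :
    Safe β o (.sum s t) e ↔ Safe β o (.sum s' t') e := by
  simp only [Safe]
  refine exists_congr fun l => exists_congr fun k => exists_congr fun r =>
    and_congr_right fun he => and_congr_right fun _ => ?_
  have := h.of_inj he
  cases k
  exacts [h₂ _ this, h₁ _ this]

theorem safe_mon_congr {s' : Ty L B} {i : Label L B} (h : OfType β e (.mon i s))
    (h₁ : ∀ a, OfType β a s → i.pos ≤ o → (Safe β o s a ↔ Safe β o s' a)) :
    Safe β o (.mon i s) e ↔ Safe β o (.mon i s') e := by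
  simp only [Safe]
  refine exists_congr fun r => and_congr_right fun he => ?_
  by_cases hi : i.pos ≤ o
  · rw [h₁ r (h.of_ret he) hi]
  · simp [hi]

theorem safe_wmon_congr {s' : Ty L B} {l : L} (h : OfType β e (.wmon l s))
    (h₁ : ∀ a, OfType β a s → l ≤ o.1 → (Safe β o s a ↔ Safe β o s' a)) :
    Safe β o (.wmon l s) e ↔ Safe β o (.wmon l s') e := by
  simp only [Safe]
  refine exists_congr fun r => and_congr_right fun he => ?_
  by_cases hl : l ≤ o.1
  · rw [h₁ r (h.of_wret he) hl]
  · simp [hl]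

/-- A visible qualifier is transparent, which reduces a pushing equation to a congruence. Under an
invisible one, the open type holds of every simply typed term; so does the other side, since the
value has the right form by termination and its parts are again open or hidden. -/
theorem TyEq.safe_iff (h : TyEq s t) : ∀ {e : Tm L B}, OfType β e s →
    (Safe β o s e ↔ Safe β o t e) := by
  induction h with
  | refl s => exact fun _ => Iff.rfl
  | symm h ih => exact fun he => (ih ((ofType_congr h).2 he)).symm
  | trans h _ ih₁ ih₂ => exact fun he => (ih₁ he).trans (ih₂ ((ofType_congr h).1 he))
  | arr h₁ _ ih₁ ih₂ => exact fun he => safe_arr_congr he h₁.erase_eq (fun _ => ih₁) fun _ => ih₂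
  | prod _ _ ih₁ ih₂ => exact fun he => safe_prod_congr he (fun _ => ih₁) fun _ => ih₂
  | sum _ _ ih₁ ih₂ => exact fun he => safe_sum_congr he (fun _ => ih₁) fun _ => ih₂
  | mon i _ ih => exact fun he => safe_mon_congr he fun _ ha _ => ih ha
  | wmon l _ ih => exact fun he => safe_wmon_congr he fun _ ha _ => ih ha
  | opn l _ ih => exact fun he => or_congr_right (ih he)
  | opn_opn s l l' =>
    intro e he
    by_cases hl : l ≤ o.1 <;> by_cases hl' : l' ≤ o.1 <;> simp [Safe, hl, hl']
  | opn_bot s => exact fun _ => (safe_opn_iff bot_le).symm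
  | opn_unit l =>
    exact fun he => iff_of_true (by
      by_cases hl : l ≤ o.1
      exacts [.inr he.safe_top, he.safe_opn hl]) he.safe_top
  | opn_prod s t l =>
    intro e he
    by_cases hl : l ≤ o.1
    · rw [safe_opn_iff hl]
      exact safe_prod_congr he (fun _ _ => (safe_opn_iff hl).symm)
        fun _ _ => (safe_opn_iff hl).symm
    · refine iff_of_true (OfType.safe_opn hl he) ?_
      obtain ⟨e₁, e₂, h⟩ := OfType.exists_pair he
      have := OfType.of_pair he h
      exact ⟨e₁, e₂, h, this.1.safe_opn hl, this.2.safe_opn hl⟩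
  | opn_arr s t l =>
    intro e he
    by_cases hl : l ≤ o.1
    · rw [safe_opn_iff hl]
      exact safe_arr_congr he rfl (fun _ _ => Iff.rfl) fun _ _ => (safe_opn_iff hl).symm
    · refine iff_of_true (OfType.safe_opn hl he) ?_
      obtain ⟨b, hb⟩ := OfType.exists_abs he
      exact ⟨b, hb, fun a ha _ => ((OfType.evals he hb).app ha).safe_opn hl⟩
  | opn_wmon s l l' =>
    intro e he
    by_cases hl : l ≤ o.1
    · rw [safe_opn_iff hl]
      exact safe_wmon_congr he fun _ _ _ => (safe_opn_iff hl).symm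
    · refine iff_of_true (OfType.safe_opn hl he) ?_
      obtain ⟨r, hr⟩ := OfType.exists_wret he
      exact ⟨r, hr, .inr ((OfType.of_wret he hr).safe_opn hl)⟩
  | opn_wmon_drop s hll =>
    intro e he
    rename_i l l'
    by_cases hl : l ≤ o.1
    · rw [safe_opn_iff hl]
    · refine iff_of_true (OfType.safe_opn hl he) ?_
      obtain ⟨r, hr⟩ := OfType.exists_wret he
      -- A level above an invisible one is invisible, so the weak protection type already hides what
      -- the dropped qualifier did.
      exact ⟨r, hr, .inl fun h => hl (hll.trans h)⟩
  | opn_mon s l i =>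
    intro e he
    by_cases hl : l ≤ o.1
    · rw [safe_opn_iff hl]
      exact safe_mon_congr he fun _ _ _ => (safe_opn_iff hl).symm
    · refine iff_of_true (OfType.safe_opn hl he) ?_
      obtain ⟨r, hr⟩ := OfType.exists_ret he
      exact ⟨r, hr, .inr ((OfType.of_ret he hr).safe_opn hl)⟩
  | opn_mon_drop s hli =>
    intro e he
    rename_i l i
    by_cases hl : l ≤ o.1
    · rw [safe_opn_iff hl]
    · refine iff_of_true (OfType.safe_opn hl he) ?_
      obtain ⟨r, hr⟩ := OfType.exists_ret he
      exact ⟨r, hr, .inl fun h => hl (hli.trans h.1)⟩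

theorem OfType.safe_taint_opn {l : L} (he : OfType β e s) (h : l ≤ o.1 → Safe β o s e) :
    Safe β o (.opn s l) (.taint l e) := by
  by_cases hl : l ≤ o.1
  · exact .inr ((h hl).taint hl)
  · exact (he.taint l).safe_opn hl

/-! ### The fundamental theorem for safety. -/

/-- The bound `P ≤ o` survives the passage under `η_i`: the content has to be safe only if `i` is
visible, and then `P ⊔ i.pos ≤ o`. -/
theorem HasType.safe {Γ : List (Ty L B)} {P : L × B} {Q : L} (h : HasType β Γ P Q e t) :
    ∀ {σ : ℕ → Tm L B}, P ≤ o →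
    (∀ n s, Γ[n]? = some s → OfType β (σ n) s ∧ Safe β o s (σ n)) →
    Safe β o t (e.subst σ) := by
  have cons : ∀ {Γ : List (Ty L B)} {σ : ℕ → Tm L B} {s : Ty L B} {a : Tm L B},
      (∀ n s, Γ[n]? = some s → OfType β (σ n) s ∧ Safe β o s (σ n)) →
      OfType β a s → Safe β o s a →
      ∀ n r, (s :: Γ)[n]? = some r → OfType β (scons a σ n) r ∧ Safe β o r (scons a σ n) :=
    fun {Γ σ s a} hσ ha hs => forall_getElem?_cons
      (p := fun r n => OfType β (scons a σ n) r ∧ Safe β o r (scons a σ n)) ⟨ha, hs⟩ hσ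
  have typed : ∀ {Γ : List (Ty L B)} {e : Tm L B} {t : Ty L B} {σ : ℕ → Tm L B} {P : L × B}
      {Q : L}, HasType β Γ P Q e t →
      (∀ n s, Γ[n]? = some s → OfType β (σ n) s ∧ Safe β o s (σ n)) →
      OfType β (e.subst σ) t :=
    fun h hσ => ofType_subst_of_erase h.simplyTyped fun n s hs => (hσ n s hs).1
  induction h with
  | var h => exact fun _ hσ => (hσ _ _ h).2
  | unit => exact fun _ _ => .refl
  | abs _ ih =>
    refine @fun σ hP hσ => Safe.abs fun a ha hs => ?_
    rw [Tm.inst_subst_liftSub]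
    exact ih hP (cons hσ ha hs)
  | app _ h₂ ih₁ ih₂ => exact fun hP hσ => (ih₁ hP hσ).app (typed h₂ hσ) (ih₂ hP hσ)
  | pair _ _ ih₁ ih₂ => exact fun hP hσ => ⟨_, _, .refl, ih₁ hP hσ, ih₂ hP hσ⟩
  | proj k _ ih => exact fun hP hσ => (ih hP hσ).proj k
  | inj k _ ih => exact fun hP hσ => (ih hP hσ).inj
  | @case _ _ _ e e₁ e₂ s₁ s₂ t l h _ _ ih ih₁ ih₂ =>
    intro σ hP hσ
    have he := typed h hσ
    have body : ∀ k r, OfType β r (pick k s₁ s₂) → Safe β o (.opn (pick k s₁ s₂) l) r →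
        Safe β o t ((pick k (e₁.subst (liftSub σ)) (e₂.subst (liftSub σ))).inst r) := by
      intro k r hr hs
      cases k
      · simp only [pick, Tm.inst_subst_liftSub]
        exact ih₂ hP (cons hσ hr hs)
      · simp only [pick, Tm.inst_subst_liftSub]
        exact ih₁ hP (cons hσ hr hs)
    by_cases hl : l ≤ o.1
    · exact ((safe_opn_iff hl).1 (ih hP hσ)).case he fun k r hr hs => body k r hr (.inr hs)
    -- With `l` invisible, nothing is known about the taint `l'` of the scrutinee. The branch,
    -- however, expects its variable at an open type with qualifier `l`, where any simply typed
    -- payload is safe.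
    · obtain ⟨l', k, r, hr⟩ := OfType.exists_inj he
      have hT := OfType.of_inj he hr
      obtain ⟨r', hr', hc⟩ := hr.case (e₁.subst (liftSub σ)) (e₂.subst (liftSub σ))
      refine (safe_iff hc).2 ?_
      have hT' : OfType β r' (pick k s₁ s₂) := by
        rcases hr' with rfl | rfl
        exacts [hT, hT.taint l']
      exact body k r' hT' (hT'.safe_opn hl)
  | @ret _ _ _ _ _ i _ ih =>
    intro σ hP hσ
    refine ⟨_, .refl, ?_⟩
    by_cases hi : i.pos ≤ o
    exacts [.inr (ih (sup_le hP hi) hσ), .inl hi]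
  | wret _ ih => exact fun hP hσ => ⟨_, .refl, .inr (ih hP hσ)⟩
  | @bind _ _ _ e a _ _ i h ha hi ih₁ ih₂ =>
    intro σ hP hσ
    by_cases hio : i.pos ≤ o
    · obtain ⟨r, he, hr⟩ := ih₁ hP hσ
      refine (safe_iff ((he.bind _).tail (.bind_ret _ _ _))).2 ?_
      rw [Tm.inst_subst_liftSub]
      exact ih₂ hP (cons hσ ((typed h hσ).of_ret he) (hr.resolve_left (not_not_intro hio)))
    -- An invisible `i` is not below `P ≤ o`, so the side condition says that the result type is
    -- protected at `i`.
    · exact OfType.safe_of_prot hio (hi.resolve_left fun h => hio (h.trans hP))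
        (typed (.bind h ha hi) hσ)
  | wbind h _ _ ih₁ ih₂ =>
    intro σ hP hσ
    obtain ⟨r, he, hr⟩ := ih₁ hP hσ
    refine (safe_iff ((he.bind _).tail (.bind_wret _ _ _))).2 ?_
    rw [Tm.inst_subst_liftSub]
    have hT := (typed h hσ).of_wret he
    exact ih₂ hP (cons hσ (hT.taint _)
      (hT.safe_taint_opn fun hl => hr.resolve_left (not_not_intro hl)))
  | weaken _ ih => exact fun hP hσ => (ih hP hσ).weaken
  | conv h hst ih => exact fun hP hσ => (hst.safe_iff (typed h hσ)).1 (ih hP hσ)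
  | taint h ih => exact fun hP hσ => (typed h hσ).safe_taint_opn fun _ => ih hP hσ

end Safe

/-! ### Indistinguishability and its fundamental theorem. -/

section Indist

variable {o : L × B} {e e' r r' : Tm L B} {s t : Ty L B}

/-- The relation skips qualifiers, and the arguments admitted at arrows depend only on the erased
type. Compatibility with the open type equations is an immediate consequence. -/
theorem indist_erase (t : Ty L B) : Indist β o t.erase e e' ↔ Indist β o t e e' := by
  have idem : ∀ t : Ty L B, t.erase.erase = t.erase := fun t => by
    induction t <;> simp_all [Ty.erase]
  induction t generalizing e e' <;> simp_all [Ty.erase, Indist, OfType]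

theorem TyEq.indist_iff (h : TyEq s t) : Indist β o s e e' ↔ Indist β o t e e' := by
  rw [← indist_erase s, h.erase_eq, indist_erase]

theorem indist_iff (h : Evals β e r) (h' : Evals β e' r') :
    Indist β o t e e' ↔ Indist β o t r r' := by
  induction t with
  | unit => simp only [Indist, evals_iff h .unit, evals_iff h' .unit]
  | arr => simp only [Indist, evals_iff h (.abs _), evals_iff h' (.abs _)]
  | prod => simp only [Indist, evals_iff h (.pair _ _), evals_iff h' (.pair _ _)]
  | sum => simp only [Indist, evalsInj_iff h, evalsInj_iff h']
  | mon => simp only [Indist, evals_iff h (.ret _ _), evals_iff h' (.ret _ _)]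
  | wmon => simp only [Indist, evals_iff h (.wret _ _), evals_iff h' (.wret _ _)]
  | opn s l ih => simp only [Indist, ih]

theorem Indist.symm (h : Indist β o t e e') : Indist β o t e' e := by
  induction t generalizing e e' with
  | unit => exact And.symm h
  | arr s t ih₁ ih₂ =>
    obtain ⟨b, b', hb, hb', h⟩ := h
    exact ⟨b', b, hb', hb, fun a a' ha ha' hs => ih₂ (h a' a ha' ha (ih₁ hs))⟩
  | prod s t ih₁ ih₂ =>
    obtain ⟨e₁, e₂, e₁', e₂', h, h', h₁, h₂⟩ := h
    exact ⟨_, _, _, _, h', h, ih₁ h₁, ih₂ h₂⟩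
  | sum s t ih₁ ih₂ =>
    obtain ⟨l, l', k, r, r', h, h', hr⟩ := h
    refine ⟨_, _, k, _, _, h', h, ?_⟩
    cases k
    exacts [ih₂ hr, ih₁ hr]
  | mon i s ih =>
    obtain ⟨r, r', h, h', hr⟩ := h
    exact ⟨_, _, h', h, hr.imp_right ih⟩
  | wmon l s ih =>
    obtain ⟨r, r', h, h', hr⟩ := h
    exact ⟨_, _, h', h, ih hr⟩
  | opn s l ih => exact ih h

/-- One side at a time, because the injections scrutinised by a `case` may carry different taints;
symmetry supplies the other side. -/
theorem Indist.taint_left (l : L) (h : Indist β o t e e') : Indist β o t (.taint l e) e' := by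
  induction t generalizing e e' with
  | unit => exact ⟨(h.1.taint l).tail (.taint_unit l), h.2⟩
  | arr s t _ ih =>
    obtain ⟨b, b', hb, hb', h⟩ := h
    refine ⟨_, b', (hb.taint l).tail (.taint_abs l b), hb', fun a a' ha ha' hs => ?_⟩
    have := ih (h a a' ha ha' hs)
    rw [indist_iff (evals_taint_app_abs l b a) .refl] at this
    rwa [indist_iff (evals_app_abs_taint l b a) .refl]
  | prod s t ih₁ ih₂ =>
    obtain ⟨e₁, e₂, e₁', e₂', h, h', h₁, h₂⟩ := h
    exact ⟨_, _, _, _, (h.taint l).tail (.taint_pair l _ _), h', ih₁ h₁, ih₂ h₂⟩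
  | sum s t =>
    obtain ⟨l₁, l₂, k, r, r', h, h', hr⟩ := h
    exact ⟨_, _, k, _, _, h.taint l, h', hr⟩
  | mon i s ih =>
    obtain ⟨r, r', h, h', hr⟩ := h
    obtain ⟨q, hq, h⟩ := h.taint_ret l
    refine ⟨q, r', h, h', hr.imp_right fun hr => ?_⟩
    rcases hq with rfl | rfl
    exacts [hr, ih hr]
  | wmon l' s ih =>
    obtain ⟨r, r', h, h', hr⟩ := h
    obtain ⟨q, hq, h⟩ := h.taint_wret l
    refine ⟨q, r', h, h', ?_⟩
    rcases hq with rfl | rfl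
    exacts [hr, ih hr]
  | opn s _ ih => exact ih h

theorem Indist.taint (l l' : L) (h : Indist β o t e e') :
    Indist β o t (.taint l e) (.taint l' e') :=
  ((h.taint_left l).symm.taint_left l').symm

theorem Indist.app {a a' : Tm L B} (h : Indist β o (.arr s t) e e') (ha : OfType β a s)
    (ha' : OfType β a' s) (hs : Indist β o s a a') :
    Indist β o t (.app e a) (.app e' a') := by
  obtain ⟨b, b', hb, hb', h⟩ := h
  exact (indist_iff (hb.app a) (hb'.app a')).2 (h a a' ha ha' hs)

/-- Here the weak protection type hides nothing, so data invisible at `l` must stay invisible at `β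
l`. Indeed `β l ≤ o.2 ≤ β o.1` would give `l ≤ o.1`, as `β` reflects the order. -/
theorem Indist.weaken (ho : o.2 ≤ β o.1) {l : L} (h : Indist β o (.mon (.level l) s) e e') :
    Indist β o (.mon (.blame (β l)) (.wmon l s)) (.weaken e) (.weaken e') := by
  obtain ⟨r, r', h, h', hr⟩ := h
  refine ⟨_, _, h.weaken.tail (.weaken_ret l r), h'.weaken.tail (.weaken_ret l r'), ?_⟩
  refine hr.imp (fun hl hb => hl ⟨?_, bot_le⟩) fun hr => ⟨r, r', .refl, .refl, hr⟩
  exact β.le_iff_le.1 (hb.2.trans ho)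

theorem OfType.indist_of_prot {i : Label L B} (hi : ¬ i.pos ≤ o) (hp : Prot i t)
    (h : OfType β e t) (h' : OfType β e' t) : Indist β o t e e' := by
  induction t generalizing e e' with
  | unit => exact ⟨h.safe_top, h'.safe_top⟩
  | arr s t _ ih =>
    obtain ⟨b, hb⟩ := h.exists_abs
    obtain ⟨b', hb'⟩ := h'.exists_abs
    exact ⟨b, b', hb, hb', fun a a' ha ha' _ =>
      ih hp ((h.evals hb).app ha) ((h'.evals hb').app ha')⟩
  | prod s t ih₁ ih₂ =>
    obtain ⟨e₁, e₂, he⟩ := h.exists_pair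
    obtain ⟨e₁', e₂', he'⟩ := h'.exists_pair
    have h := h.of_pair he
    have h' := h'.of_pair he'
    exact ⟨_, _, _, _, he, he', ih₁ hp.1 h.1 h'.1, ih₂ hp.2 h.2 h'.2⟩
  | sum => exact hp.elim
  | mon j s ih =>
    obtain ⟨r, he⟩ := h.exists_ret
    obtain ⟨r', he'⟩ := h'.exists_ret
    exact ⟨r, r', he, he', hp.imp (fun hij hj => hi (hij.trans hj)) fun hp =>
      ih hp (h.of_ret he) (h'.of_ret he')⟩
  | wmon l s ih =>
    obtain ⟨r, he⟩ := h.exists_wret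
    obtain ⟨r', he'⟩ := h'.exists_wret
    exact ⟨r, r', he, he', ih hp (h.of_wret he) (h'.of_wret he')⟩
  | opn => exact hp.elim

/-- The argument parallels `HasType.safe`, except that taints and qualifiers play no role and
`weaken` calls for `ho`. -/
theorem HasType.indist (ho : o.2 ≤ β o.1) {Γ : List (Ty L B)} {P : L × B} {Q : L}
    (h : HasType β Γ P Q e t) : ∀ {σ σ' : ℕ → Tm L B}, P ≤ o →
    (∀ n s, Γ[n]? = some s →
      OfType β (σ n) s ∧ OfType β (σ' n) s ∧ Indist β o s (σ n) (σ' n)) →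
    Indist β o t (e.subst σ) (e.subst σ') := by
  have cons : ∀ {Γ : List (Ty L B)} {σ σ' : ℕ → Tm L B} {s : Ty L B} {a a' : Tm L B},
      (∀ n s, Γ[n]? = some s →
        OfType β (σ n) s ∧ OfType β (σ' n) s ∧ Indist β o s (σ n) (σ' n)) →
      OfType β a s → OfType β a' s → Indist β o s a a' →
      ∀ n r, (s :: Γ)[n]? = some r → OfType β (scons a σ n) r ∧ OfType β (scons a' σ' n) r ∧
        Indist β o r (scons a σ n) (scons a' σ' n) :=
    fun {Γ σ σ' s a a'} hσ ha ha' hs => forall_getElem?_cons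
      (p := fun r n => OfType β (scons a σ n) r ∧ OfType β (scons a' σ' n) r ∧
        Indist β o r (scons a σ n) (scons a' σ' n)) ⟨ha, ha', hs⟩ hσ
  have typed : ∀ {Γ : List (Ty L B)} {e : Tm L B} {t : Ty L B} {σ σ' : ℕ → Tm L B} {P : L × B}
      {Q : L}, HasType β Γ P Q e t →
      (∀ n s, Γ[n]? = some s →
        OfType β (σ n) s ∧ OfType β (σ' n) s ∧ Indist β o s (σ n) (σ' n)) →
      OfType β (e.subst σ) t ∧ OfType β (e.subst σ') t :=
    fun h hσ => ⟨ofType_subst_of_erase h.simplyTyped fun n s hs => (hσ n s hs).1,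
      ofType_subst_of_erase h.simplyTyped fun n s hs => (hσ n s hs).2.1⟩
  induction h with
  | var h => exact fun _ hσ => (hσ _ _ h).2.2
  | unit => exact fun _ _ => ⟨.refl, .refl⟩
  | abs _ ih =>
    refine @fun σ σ' hP hσ => ⟨_, _, .refl, .refl, fun a a' ha ha' hs => ?_⟩
    refine (indist_iff (.single (.beta _ _)) (.single (.beta _ _))).2 ?_
    simp only [Tm.inst_subst_liftSub]
    exact ih hP (cons hσ ha ha' hs)
  | app _ h₂ ih₁ ih₂ =>
    exact fun hP hσ => (ih₁ hP hσ).app (typed h₂ hσ).1 (typed h₂ hσ).2 (ih₂ hP hσ)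
  | pair _ _ ih₁ ih₂ => exact fun hP hσ => ⟨_, _, _, _, .refl, .refl, ih₁ hP hσ, ih₂ hP hσ⟩
  | proj k _ ih =>
    intro σ σ' hP hσ
    obtain ⟨e₁, e₂, e₁', e₂', h, h', h₁, h₂⟩ := ih hP hσ
    refine (indist_iff ((h.proj k).tail (.proj_pair _ _ _))
      ((h'.proj k).tail (.proj_pair _ _ _))).2 ?_
    cases k
    exacts [h₂, h₁]
  | inj k _ ih =>
    intro σ σ' hP hσ
    refine ⟨⊥, ⊥, k, _, _, .inr ⟨rfl, .refl⟩, .inr ⟨rfl, .refl⟩, ?_⟩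
    have := ih hP hσ
    cases k <;> exact this
  | @case _ _ _ e e₁ e₂ s₁ s₂ t l h _ _ ih ih₁ ih₂ =>
    intro σ σ' hP hσ
    obtain ⟨l₁, l₂, k, r, r', hr, hr', hs⟩ := ih hP hσ
    have hs : Indist β o (pick k s₁ s₂) r r' := by cases k <;> exact hs
    have hT := OfType.of_inj (typed h hσ).1 hr
    have hT' := OfType.of_inj (typed h hσ).2 hr'
    obtain ⟨q, hq, hc⟩ := hr.case (e₁.subst (liftSub σ)) (e₂.subst (liftSub σ))
    obtain ⟨q', hq', hc'⟩ := hr'.case (e₁.subst (liftSub σ')) (e₂.subst (liftSub σ'))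
    refine (indist_iff hc hc').2 ?_
    -- Each payload is bare or tainted independently of the other.
    have body : OfType β q (pick k s₁ s₂) ∧ OfType β q' (pick k s₁ s₂) ∧
        Indist β o (pick k s₁ s₂) q q' := by
      rcases hq with rfl | rfl <;> rcases hq' with rfl | rfl
      · exact ⟨hT, hT', hs⟩
      · exact ⟨hT, hT'.taint _, (hs.symm.taint_left _).symm⟩
      · exact ⟨hT.taint _, hT', hs.taint_left _⟩
      · exact ⟨hT.taint _, hT'.taint _, hs.taint _ _⟩
    cases k
    · simp only [pick, Tm.inst_subst_liftSub] at body ⊢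
      exact ih₂ hP (cons hσ body.1 body.2.1 body.2.2)
    · simp only [pick, Tm.inst_subst_liftSub] at body ⊢
      exact ih₁ hP (cons hσ body.1 body.2.1 body.2.2)
  | @ret _ _ _ _ _ i _ ih =>
    intro σ σ' hP hσ
    refine ⟨_, _, .refl, .refl, ?_⟩
    by_cases hi : i.pos ≤ o
    exacts [.inr (ih (sup_le hP hi) hσ), .inl hi]
  | wret _ ih => exact fun hP hσ => ⟨_, _, .refl, .refl, ih hP hσ⟩
  | @bind _ _ _ e a _ _ i h ha hi ih₁ ih₂ =>
    intro σ σ' hP hσ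
    by_cases hio : i.pos ≤ o
    · obtain ⟨r, r', he, he', hr⟩ := ih₁ hP hσ
      refine (indist_iff ((he.bind _).tail (.bind_ret _ _ _))
        ((he'.bind _).tail (.bind_ret _ _ _))).2 ?_
      simp only [Tm.inst_subst_liftSub]
      exact ih₂ hP (cons hσ ((typed h hσ).1.of_ret he) ((typed h hσ).2.of_ret he')
        (hr.resolve_left (not_not_intro hio)))
    · have := typed (.bind h ha hi) hσ
      exact this.1.indist_of_prot hio (hi.resolve_left fun h => hio (h.trans hP)) this.2
  | wbind h _ _ ih₁ ih₂ =>
    intro σ σ' hP hσ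
    obtain ⟨r, r', he, he', hr⟩ := ih₁ hP hσ
    refine (indist_iff ((he.bind _).tail (.bind_wret _ _ _))
      ((he'.bind _).tail (.bind_wret _ _ _))).2 ?_
    simp only [Tm.inst_subst_liftSub]
    exact ih₂ hP (cons hσ (((typed h hσ).1.of_wret he).taint _)
      (((typed h hσ).2.of_wret he').taint _) (hr.taint _ _))
  | weaken _ ih => exact fun hP hσ => (ih hP hσ).weaken ho
  | conv _ hst ih => exact fun hP hσ => hst.indist_iff.1 (ih hP hσ)
  | taint _ ih => exact fun hP hσ => (ih hP hσ).taint _ _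

/-- Blames that are not below the blame of a type do not help to observe data of that type. -/
theorem indist_inf_iff {l : L} {δ b : B} (hb : t.blames ≤ b) :
    Indist β (l, δ ⊓ b) t e e' ↔ Indist β (l, δ) t e e' := by
  induction t generalizing e e' with
  | unit => rfl
  | arr s t ih₁ ih₂ =>
    have := sup_le_iff.1 hb
    simp only [Indist, ih₁ this.1, ih₂ this.2]
  | prod s t ih₁ ih₂ =>
    have := sup_le_iff.1 hb
    simp only [Indist, ih₁ this.1, ih₂ this.2]
  | sum s t ih₁ ih₂ =>
    have := sup_le_iff.1 hb
    simp only [Indist, ih₁ this.1, ih₂ this.2]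
  | mon i s ih =>
    cases i with
    | level i => simp [Indist, ih hb, Label.pos, Prod.le_def]
    -- As `i ≤ b`, meeting with `b` does not affect whether `i` is visible.
    | blame i =>
      have := sup_le_iff.1 hb
      simp [Indist, ih this.2, Label.pos, Prod.le_def, this.1]
  | wmon l s ih => simp only [Indist, ih hb]
  | opn s l ih => exact ih hb

end Indist

/-! ### Closed typed terms and the theorem. -/

theorem Typed.ofType {e : Tm L B} {t : Ty L B} (h : Typed β e t) : OfType β e t :=
  HasType.simplyTyped h

theorem Typed.safe {e : Tm L B} {t : Ty L B} (h : Typed β e t) (o : L × B) : Safe β o t e := by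
  have := HasType.safe h (σ := Tm.var) (bot_le : ⊥ ≤ o) (by simp)
  rwa [Tm.subst_var] at this

theorem Typed.indist {e : Tm L B} {t : Ty L B} (h : Typed β e t) {o : L × B}
    (ho : o.2 ≤ β o.1) : Indist β o t e e := by
  have := HasType.indist ho h (σ := Tm.var) (σ' := Tm.var) bot_le (by simp)
  rwa [Tm.subst_var] at this

end System

end DCC

theorem theorem6 {L B : Type*} [Lattice L] [BoundedOrder L] [Lattice B] [BoundedOrder B]
    (β : L ≃o B) :
    (∀ (l : L) (s t : DCC.Ty L B) (e e₁ e₂ : DCC.Tm L B),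
      DCC.Typed β e (.arr (.mon (.level l) s) t) → DCC.Typed β e₁ s → DCC.Typed β e₂ s →
      ¬ l ≤ β.symm t.blames →
      ∀ l' : L, ¬ l ≤ l' → ∀ δ : B, δ ⊓ t.blames ≤ β l' →
        DCC.Indist β (l', δ) t (.app e (.ret (.level l) e₁)) (.app e (.ret (.level l) e₂))) ∧
    (∀ (l : L) (s t : DCC.Ty L B) (e e₀ : DCC.Tm L B),
      DCC.Typed β e (.arr (.wmon l s) t) → DCC.Typed β e₀ s →
      ∀ l' : L, ¬ l ≤ l' → ∀ δ : B,
        DCC.Safe β (l', δ) t (.app e (.wret l e₀))) := by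
  refine ⟨fun l s t e e₁ e₂ he h₁ h₂ _ l' hl δ hδ => ?_, fun l s t e e₀ he h₀ l' hl δ => ?_⟩
  -- After replacing `δ` by `δ ⊓ t.blames`, the assumption on `δ` is exactly the bound that the
  -- fundamental theorem asks of the observer.
  · rw [← DCC.indist_inf_iff le_rfl]
    exact (he.indist (o := (l', δ ⊓ t.blames)) hδ).app (.ret h₁.ofType) (.ret h₂.ofType)
      -- The arguments are related because `l` is invisible, whatever `e₁` and `e₂` are.
      ⟨e₁, e₂, .refl, .refl, .inl fun h => hl h.1⟩
  · exact (he.safe (l', δ)).app (.wret h₀.ofType) ⟨e₀, .refl, .inl hl⟩
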